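/- Let $k,d\ge 1$ and let $\Theta_d=\{\vartheta_1<\dots<\vartheta_d\}\subset(0,\infty)$. Put $D=d^k$ and write $\Theta_d^k=\{\boldsymbol\vartheta_1,\dots,\boldsymbol\vartheta_D\}$ with $\boldsymbol\vartheta_i=(\boldsymbol\vartheta_{i,1},\dots,\boldsymbol\vartheta_{i,k})$. For $\mathbf y\in\mathbb N_0^k$ and a probability mass function $g$ on $\Theta_d^k$ let $$k(\mathbf y\mid\boldsymbol\vartheta_i)=\prod_{j=1}^k e^{-\boldsymbol\vartheta_{i,j}}\frac{\boldsymbol\vartheta_{i,j}^{\mathbf y_j}}{\mathbf y_j!},\qquad p_g(\mathbf y)=\sum_{i=1}^D k(\mathbf y\mid\boldsymbol\vartheta_i)g(\boldsymbol\vartheta_i),\qquad g(\boldsymbol\vartheta_i\mid\mathbf y)=\frac{k(\mathbf y\mid\boldsymbol\vartheta_i)g(\boldsymbol\vartheta_i)}{p_g(\mathbf y)},$$ and let $\hat{\boldsymbol\theta}_g(\mathbf y)\in\mathbb R^k$ be the vector with coordinates $$\hat{\boldsymbol\theta}_{g,j}(\mathbf y)=(\mathbf y_j+1)\frac{p_g(\mathbf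 y+\mathbf e_j)}{p_g(\mathbf y)},\qquad j=1,\dots,k,$$ where $\mathbf e_j$ is the $j$-th unit vector. Let $(\alpha_n)_{n\ge1}$ be numbers in $(0,1)$ with $\sum_n\alpha_n^2<\infty$, and let $g_0$ be a (deterministic) probability mass function on $\Theta_d^k$ with $g_0(\boldsymbol\vartheta_i)>0$ for all $i$. On a probability space $(\Omega,\mathcal F,\mathbb P)$ let $(\mathbf Y_n)_{n\ge1}$ be random vectors in $\mathbb N_0^k$ with natural filtration $\mathcal G_n=\sigma(\mathbf Y_1,\dots,\mathbf Y_n)$, define recursively $$g_{n+1}(\boldsymbol\vartheta_i)=(1-\alpha_{n+1})g_n(\boldsymbol\vartheta_i)+\alpha_{n+1}\,g_n(\boldsymbol\vartheta_i\mid\mathbf Y_{n+1}),\qquad i=1,\dots,D,$$ and assume that $\mathbb P(\mathbf Y_{n+1}=\mathbf y\mid\mathcal G_n)=p_{g_n}(\mathbf y)$ a.s. for all $n\ge0$ and $\mathbf y\in\mathbb N_0^k$. Let $(b_n)_{n\ge1}$ be strictly positive numbers with $$b_n\uparrow+\infty,\qquad\sum_{n\ge1}\alpha_n^4b_n^2<+\infty,\qquad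 b_n\sup_{m\ge n}\alpha_m^2\to0,\qquad b_n\sum_{m\ge n}\alpha_m^2\to1.$$ Then $g_n$ converges $\mathbb P$-a.s. to a random probability mass function $\tilde g$ on $\Theta_d^k$, and, for every $\mathbf y\in\mathbb N_0^k$, the sequence $b_n^{1/2}\bigl(\hat{\boldsymbol\theta}_{g_n}(\mathbf y)-\hat{\boldsymbol\theta}_{\tilde g}(\mathbf y)\bigr)$ converges, in the sense of almost-sure conditional convergence with respect to $(\mathcal G_n)$, to the centered Gaussian kernel on $\mathbb R^k$ whose random covariance matrix is a.s. equal to $\mathbf W(\mathbf y)$, with $(j,j')$ element $$\mathbf W_{j,j'}(\mathbf y)=\hat{\boldsymbol\theta}_{\tilde g,j}(\mathbf y)\,\hat{\boldsymbol\theta}_{\tilde g,j'}(\mathbf y)\,E_{\mathbf Z\sim p_{\tilde g}}\bigl[S_j(\mathbf Z)S_{j'}(\mathbf Z)\bigr],\qquad S_j(\mathbf z)=\sum_{i=1}^D\frac{\tilde g(\boldsymbol\vartheta_i\mid\mathbf z)}{\tilde g(\boldsymbol\vartheta_i)}\bigl(\tilde g(\boldsymbol\vartheta_i\mid\mathbf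 y+\mathbf e_j)-\tilde g(\boldsymbol\vartheta_i\mid\mathbf y)\bigr),$$ where a summand with $\tilde g(\boldsymbol\vartheta_i)=0$ is read as $0$, and the expectation (over $\mathbf Z$, with $\tilde g$ held fixed) is a.s. an absolutely convergent sum. That is: for $\mathbb P$-almost every $\omega$, the regular conditional distribution of $b_n^{1/2}\bigl(\hat{\boldsymbol\theta}_{g_n}(\mathbf y)-\hat{\boldsymbol\theta}_{\tilde g}(\mathbf y)\bigr)$ given $\mathcal G_n$, evaluated at $\omega$, converges weakly as $n\to\infty$ to the Gaussian distribution $\mathcal N(0,\mathbf W(\mathbf y)(\omega))$ (possibly degenerate). -/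

import Mathlib

open MeasureTheory ProbabilityTheory Filter Topology

namespace PoissonQB

noncomputable section

/-! ### Almost-sure conditional convergence and Gaussian kernels -/

/-- The regular conditional distribution of `X` given the sub-σ-algebra `m`. -/
def condLaw {Ω E : Type*} {mΩ : MeasurableSpace Ω} (μ : Measure Ω) [IsProbabilityMeasure μ]
    [TopologicalSpace E] [PolishSpace E] [MeasurableSpace E] [BorelSpace E] [Nonempty E]
    (m : MeasurableSpace Ω) (X : Ω → E) : @Kernel Ω E m _ :=
  @condDistrib Ω Ω E _ _ _ mΩ m X id μ _

instance condLaw_isMarkovKernel {Ω E : Type*} {mΩ : MeasurableSpace Ω} (μ : Measure Ω)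
    [IsProbabilityMeasure μ]
    [TopologicalSpace E] [PolishSpace E] [MeasurableSpace E] [BorelSpace E] [Nonempty E]
    (m : MeasurableSpace Ω) (X : Ω → E) : @IsMarkovKernel Ω E m _ (condLaw μ m X) := by
  unfold condLaw
  infer_instance

/-- The regular conditional distribution of `X` given `m`, at the outcome `ω`. -/
def condLawAt {Ω E : Type*} {mΩ : MeasurableSpace Ω} (μ : Measure Ω) [IsProbabilityMeasure μ]
    [TopologicalSpace E] [PolishSpace E] [MeasurableSpace E] [BorelSpace E] [Nonempty E]
    (m : MeasurableSpace Ω) (X : Ω → E) (ω : Ω) : ProbabilityMeasure E :=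
  ⟨condLaw μ m X ω, (condLaw_isMarkovKernel μ m X).isProbabilityMeasure ω⟩

/-- The sequence `X` converges to the kernel `K` in the sense of almost-sure conditional
convergence with respect to the filtration `𝒢`: for almost every `ω`, the conditional
distribution of `X n` given `𝒢 n` at `ω` converges weakly to `K ω`. -/
def AlmostSureCondConv {Ω E : Type*} {mΩ : MeasurableSpace Ω} (μ : Measure Ω)
    [IsProbabilityMeasure μ]
    [TopologicalSpace E] [PolishSpace E] [MeasurableSpace E] [BorelSpace E] [Nonempty E]
    (𝒢 : Filtration ℕ mΩ) (X : ℕ → Ω → E) (K : Kernel Ω E) [IsMarkovKernel K] : Prop :=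
  (∀ n, AEMeasurable (X n) μ) ∧
    ∀ᵐ ω ∂μ, Tendsto (fun n => condLawAt μ (𝒢 n) (X n) ω) atTop
      (𝓝 (⟨K ω, inferInstance⟩ : ProbabilityMeasure E))

/-- `K` is the centered Gaussian kernel on `ℝᵏ` with random covariance matrix `S`. -/
structure IsCenteredGaussianKernel {Ω : Type*} {mΩ : MeasurableSpace Ω} {k : ℕ}
    (K : Kernel Ω (EuclideanSpace ℝ (Fin k))) (S : Ω → Matrix (Fin k) (Fin k) ℝ) : Prop where
  measurable_cov : ∀ j j', Measurable fun ω => S ω j j'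
  posSemidef_cov : ∀ ω, (S ω).PosSemidef
  eq_gaussian : ∀ ω, K ω = multivariateGaussian 0 (S ω)

/-! ### The Poisson mixture

The grid `Θ_d = {ϑ 0, …, ϑ (d - 1)}` is given by `ϑ : Fin d → ℝ`; a point of the product grid
`Θ_dᵏ` is given by its index `i : Fin k → Fin d`, its `j`-th coordinate being `ϑ (i j)`. -/

/-- The product Poisson kernel `k(y ∣ ϑ_i) = ∏ⱼ exp (-ϑ_{i,j}) ϑ_{i,j} ^ yⱼ / yⱼ!`. -/
def poissonKernel {k d : ℕ} (ϑ : Fin d → ℝ) (y : Fin k → ℕ) (i : Fin k → Fin d) : ℝ :=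
  ∏ j, Real.exp (-ϑ (i j)) * ϑ (i j) ^ y j / (y j).factorial

/-- The mixture `p_g(y) = ∑ᵢ k(y ∣ ϑ_i) g(ϑ_i)`. -/
def mixture {k d : ℕ} (ϑ : Fin d → ℝ) (g : (Fin k → Fin d) → ℝ) (y : Fin k → ℕ) : ℝ :=
  ∑ i, poissonKernel ϑ y i * g i

/-- The posterior `g(ϑ_i ∣ y) = k(y ∣ ϑ_i) g(ϑ_i) / p_g(y)`. -/
def posterior {k d : ℕ} (ϑ : Fin d → ℝ) (g : (Fin k → Fin d) → ℝ) (y : Fin k → ℕ)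
    (i : Fin k → Fin d) : ℝ :=
  poissonKernel ϑ y i * g i / mixture ϑ g y

/-- The estimate `θ̂_g(y)`, with `j`-th coordinate `(yⱼ + 1) p_g(y + eⱼ) / p_g(y)`. -/
def thetaHat {k d : ℕ} (ϑ : Fin d → ℝ) (g : (Fin k → Fin d) → ℝ) (y : Fin k → ℕ) :
    EuclideanSpace ℝ (Fin k) :=
  WithLp.toLp 2 fun j => ((y j : ℝ) + 1) * mixture ϑ g (y + Pi.single j 1) / mixture ϑ g y

/-- The variable `∑ᵢ g(ϑ_i ∣ z) / g(ϑ_i) * (g(ϑ_i ∣ y + eⱼ) - g(ϑ_i ∣ y))`. If `g(ϑ_i) = 0`, then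
`g(ϑ_i ∣ ·)` vanishes too, and the `i`-th summand is zero. -/
def score {k d : ℕ} (ϑ : Fin d → ℝ) (g : (Fin k → Fin d) → ℝ) (y : Fin k → ℕ) (j : Fin k)
    (z : Fin k → ℕ) : ℝ :=
  ∑ i, posterior ϑ g z i / g i * (posterior ϑ g (y + Pi.single j 1) i - posterior ϑ g y i)

/-- The matrix `W_g(y)`, with `(j, j')` element
`θ̂_{g,j}(y) θ̂_{g,j'}(y) E_{Z ∼ p_g} [score_j(Z) score_{j'}(Z)]`. -/
def covW {k d : ℕ} (ϑ : Fin d → ℝ) (g : (Fin k → Fin d) → ℝ) (y : Fin k → ℕ) :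
    Matrix (Fin k) (Fin k) ℝ :=
  fun j j' => thetaHat ϑ g y j * thetaHat ϑ g y j' *
    ∑' z : Fin k → ℕ, mixture ϑ g z * (score ϑ g y j z * score ϑ g y j' z)

/-! ### The learning model

Observations and learning rates are indexed from `1`; the values `Y 0` and `α 0` play no role. -/

/-- Newton's algorithm run along the observations `y 1, y 2, …`. -/
def newton {k d : ℕ} (ϑ : Fin d → ℝ) (α : ℕ → ℝ) (g₀ : (Fin k → Fin d) → ℝ)
    (y : ℕ → Fin k → ℕ) : ℕ → (Fin k → Fin d) → ℝ
  | 0 => g₀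
  | n + 1 => fun i => (1 - α (n + 1)) * newton ϑ α g₀ y n i +
      α (n + 1) * posterior ϑ (newton ϑ α g₀ y n) (y (n + 1)) i

/-- The natural filtration `𝒢 n = σ(Y 1, …, Y n)`. -/
def obsFiltration {Ω : Type*} {mΩ : MeasurableSpace Ω} {k : ℕ} (Y : ℕ → Ω → Fin k → ℕ)
    (hY : ∀ n, Measurable (Y n)) : Filtration ℕ mΩ where
  seq n := ⨆ m ∈ Finset.Icc 1 n, MeasurableSpace.comap (Y m) inferInstance
  mono' n n' h := by
    refine iSup₂_le fun m hm => ?_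
    rw [Finset.mem_Icc] at hm
    exact le_iSup₂_of_le m (Finset.mem_Icc.2 ⟨hm.1, hm.2.trans h⟩) le_rfl
  le' n := iSup₂_le fun m _ => (hY m).comap_le

/-- The learning model: given `𝒢 n`, the observation `Y (n + 1)` has mass function `p_{g_n}`. -/
def IsLearningModel {Ω : Type*} {mΩ : MeasurableSpace Ω} (μ : Measure Ω) {k d : ℕ}
    (ϑ : Fin d → ℝ) (α : ℕ → ℝ) (g₀ : (Fin k → Fin d) → ℝ) (Y : ℕ → Ω → Fin k → ℕ)
    (hY : ∀ n, Measurable (Y n)) : Prop :=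
  ∀ (n : ℕ) (y : Fin k → ℕ),
    μ[(Y (n + 1) ⁻¹' {y}).indicator (fun _ => (1 : ℝ)) | obsFiltration Y hY n] =ᵐ[μ]
      fun ω => mixture ϑ (newton ϑ α g₀ (fun m => Y m ω) n) y

/-- The pointwise limit `g̃` of `(g_n)` along the observations `y 1, y 2, …`; it is meaningful where
the limit exists. -/
def newtonLimit {k d : ℕ} (ϑ : Fin d → ℝ) (α : ℕ → ℝ) (g₀ : (Fin k → Fin d) → ℝ)
    (y : ℕ → Fin k → ℕ) (i : Fin k → Fin d) : ℝ :=
  limUnder atTop fun n => newton ϑ α g₀ y n i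

end

end PoissonQB

namespace PoissonQB

variable {k d : ℕ} {ϑ : Fin d → ℝ}

/-! ### The Poisson kernel and its mixtures -/

/-! Under the predictive law `p_g` the posterior averages to `g`. Hence each weight of `g_n` is a
martingale in `[0, 1]` and converges a.s. to that of `g̃`. Its increments are `α_{n+1}` times
centered variables bounded by one, so the conditional mean of `(g̃ - g_n)²` given `𝒢 n` is at most
`R_n = ∑_{m > n} α_m²`.

The estimate is a ratio of two linear functions of `g`, with denominator bounded below on the
simplex. In a direction `t`, the error at time `n` is therefore a linear functional of `g̃ - g_n`,
with `𝒢 n`-measurable coefficients `dirCoef`, up to a quadratic remainder. Rescaled by `β = √b_n`,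
this remainder has conditional mean `O(β R_n)`, which tends to zero.

The Gaussian limit comes from a Lindeberg-type replacement. Let `v` be the predictive variance
`postVar` of the functional, frozen at `g_n`. In `interp`, the increments up to time `N` are the
true ones, and the later ones are represented by Gaussian factors of variance `β² v α_{l+1}²`.
Passing from `N` to `N + 1` costs a third-order Taylor remainder and the discrepancy between the
variances at `g_N` and `g_n`; the latter is controlled by `abs_postVar_sub_le` and the `L²` bound.
With `s` a bound for the later rates, the total cost is of order `(β s + √R_n) β² R_n`, a
deterministic sequence tending to zero.

These estimates are made on every `A ∈ 𝒢 n`, with a factor `μ A`, so they become almost sure bounds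
on conditional characteristic functions; this is what yields almost-sure conditional convergence. As
`b_n R_n → 1` and `postVar` is continuous, the limit at `t` is `exp (-postVar / 2)` evaluated at
`g̃`, and this `postVar` is the quadratic form of `W` (`dotProduct_covW_mulVec`). A Lipschitz bound
in `t` and a countable dense set of directions give one null set for all `t`, and Lévy's continuity
theorem concludes. -/

lemma poissonKernel_pos (hϑ : ∀ i, 0 < ϑ i) (y : Fin k → ℕ) (i : Fin k → Fin d) :
    0 < poissonKernel ϑ y i :=
  Finset.prod_pos fun j _ => by have := hϑ (i j); positivity

lemma hasSum_poissonKernel (hϑ : ∀ i, 0 < ϑ i) (i : Fin k → Fin d) :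
    HasSum (fun y : Fin k → ℕ => poissonKernel ϑ y i) 1 := by
  let ν : Measure (Fin k → ℕ) := Measure.pi fun j => poissonMeasure (ϑ (i j)).toNNReal
  have hν (y : Fin k → ℕ) : ν.real {y} = poissonKernel ϑ y i := by
    rw [measureReal_def, Measure.pi_singleton, ENNReal.toReal_prod]
    refine Finset.prod_congr rfl fun j _ => ?_
    rw [← measureReal_def, poissonMeasure_real_singleton, Real.coe_toNNReal _ (hϑ _).le]
  have h : HasSum (fun y => ν.real {y}) (ν.real (⋃ y, {y})) := by
    have h' : ∑' y : Fin k → ℕ, ν {y} = ν (⋃ y, {y}) :=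
      (measure_iUnion (fun a b hab => by simpa using hab) fun y => measurableSet_singleton y).symm
    have hs := ENNReal.hasSum_toReal (f := fun y => ν {y}) (by rw [h']; exact measure_ne_top _ _)
    rwa [← ENNReal.tsum_toReal_eq fun y => measure_ne_top _ _, h'] at hs
  rw [Set.iUnion_of_singleton, probReal_univ] at h
  simpa only [hν] using h

lemma mixture_nonneg (hϑ : ∀ i, 0 < ϑ i) {g : (Fin k → Fin d) → ℝ} (hg : g ∈ stdSimplex ℝ _)
    (z : Fin k → ℕ) : 0 ≤ mixture ϑ g z :=
  Finset.sum_nonneg fun i _ => mul_nonneg (poissonKernel_pos hϑ z i).le (hg.1 i)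

/-- A mixture is at least the smallest of its finitely many positive kernels. The bound does not
depend on `g`, so it survives in the limit `g̃` even when some of its weights vanish. -/
lemma exists_le_mixture (hϑ : ∀ i, 0 < ϑ i) (z : Fin k → ℕ) :
    ∃ c > 0, ∀ g : (Fin k → Fin d) → ℝ, g ∈ stdSimplex ℝ _ → c ≤ mixture ϑ g z := by
  obtain ⟨c, hc, h⟩ : ∃ c > 0, ∀ i, c ≤ poissonKernel ϑ z i := by
    rcases isEmpty_or_nonempty (Fin k → Fin d) with he | he
    · exact ⟨1, one_pos, fun i => he.elim i⟩
    · obtain ⟨i, hi⟩ := Finite.exists_min fun i => poissonKernel ϑ z i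
      exact ⟨_, poissonKernel_pos hϑ z i, hi⟩
  refine ⟨c, hc, fun g hg => ?_⟩
  calc c = ∑ i, c * g i := by rw [← Finset.mul_sum, hg.2, mul_one]
    _ ≤ _ := Finset.sum_le_sum fun i _ => mul_le_mul_of_nonneg_right (h i) (hg.1 i)

lemma mixture_pos (hϑ : ∀ i, 0 < ϑ i) {g : (Fin k → Fin d) → ℝ} (hg : g ∈ stdSimplex ℝ _)
    (z : Fin k → ℕ) : 0 < mixture ϑ g z := by
  obtain ⟨c, hc, h⟩ := exists_le_mixture hϑ z
  exact hc.trans_le (h g hg)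

lemma hasSum_poissonKernel_mul (hϑ : ∀ i, 0 < ϑ i) (w : (Fin k → Fin d) → ℝ) :
    HasSum (fun z : Fin k → ℕ => ∑ i, poissonKernel ϑ z i * w i) (∑ i, w i) := by
  simpa using hasSum_sum fun i (_ : i ∈ Finset.univ) => (hasSum_poissonKernel hϑ i).mul_right (w i)

lemma hasSum_mixture (hϑ : ∀ i, 0 < ϑ i) {g : (Fin k → Fin d) → ℝ} (hg : g ∈ stdSimplex ℝ _) :
    HasSum (mixture ϑ g) 1 :=
  hg.2 ▸ hasSum_poissonKernel_mul hϑ g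

lemma summable_mixture_smul {E : Type*} [NormedAddCommGroup E] [NormedSpace ℝ E] [CompleteSpace E]
    (hϑ : ∀ i, 0 < ϑ i) {g : (Fin k → Fin d) → ℝ} (hg : g ∈ stdSimplex ℝ _)
    {f : (Fin k → ℕ) → E} {C : ℝ} (hf : ∀ z, ‖f z‖ ≤ C) :
    Summable fun z => mixture ϑ g z • f z := by
  refine Summable.of_norm_bounded ((hasSum_mixture hϑ hg).summable.mul_right C) fun z => ?_
  rw [norm_smul, Real.norm_of_nonneg (mixture_nonneg hϑ hg z)]
  exact mul_le_mul_of_nonneg_left (hf z) (mixture_nonneg hϑ hg z)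

lemma norm_tsum_mixture_smul_le {E : Type*} [NormedAddCommGroup E] [NormedSpace ℝ E]
    [CompleteSpace E]
    (hϑ : ∀ i, 0 < ϑ i) {g : (Fin k → Fin d) → ℝ} (hg : g ∈ stdSimplex ℝ _)
    {f : (Fin k → ℕ) → E} {C : ℝ} (hf : ∀ z, ‖f z‖ ≤ C) :
    ‖∑' z, mixture ϑ g z • f z‖ ≤ C := by
  refine tsum_of_norm_bounded (by simpa using (hasSum_mixture hϑ hg).mul_right C) fun z => ?_
  rw [norm_smul, Real.norm_of_nonneg (mixture_nonneg hϑ hg z)]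
  exact mul_le_mul_of_nonneg_left (hf z) (mixture_nonneg hϑ hg z)

lemma posterior_nonneg (hϑ : ∀ i, 0 < ϑ i) {g : (Fin k → Fin d) → ℝ} (hg : g ∈ stdSimplex ℝ _)
    (z : Fin k → ℕ) (i : Fin k → Fin d) : 0 ≤ posterior ϑ g z i :=
  div_nonneg (mul_nonneg (poissonKernel_pos hϑ z i).le (hg.1 i)) (mixture_nonneg hϑ hg z)

lemma posterior_mem_stdSimplex (hϑ : ∀ i, 0 < ϑ i) {g : (Fin k → Fin d) → ℝ}
    (hg : g ∈ stdSimplex ℝ _) (z : Fin k → ℕ) : posterior ϑ g z ∈ stdSimplex ℝ _ := by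
  refine ⟨posterior_nonneg hϑ hg z, ?_⟩
  simp only [posterior, ← Finset.sum_div]
  exact div_self (mixture_pos hϑ hg z).ne'

lemma mixture_mul_posterior (hϑ : ∀ i, 0 < ϑ i) {g : (Fin k → Fin d) → ℝ}
    (hg : g ∈ stdSimplex ℝ _) (z : Fin k → ℕ) (i : Fin k → Fin d) :
    mixture ϑ g z * posterior ϑ g z i = poissonKernel ϑ z i * g i :=
  mul_div_cancel₀ _ (mixture_pos hϑ hg z).ne'

/-- Bayes' formula cancels the mixture and leaves a kernel of total mass one. This is the source of
the martingale property of `g_n`. -/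
lemma hasSum_mixture_mul_posterior (hϑ : ∀ i, 0 < ϑ i) {g : (Fin k → Fin d) → ℝ}
    (hg : g ∈ stdSimplex ℝ _) (i : Fin k → Fin d) :
    HasSum (fun z => mixture ϑ g z * posterior ϑ g z i) (g i) := by
  simpa [mixture_mul_posterior hϑ hg] using (hasSum_poissonKernel hϑ i).mul_right (g i)

lemma le_one_of_mem_stdSimplex {ι : Type*} [Fintype ι] {g : ι → ℝ} (hg : g ∈ stdSimplex ℝ ι)
    (i : ι) : g i ≤ 1 :=
  hg.2 ▸ Finset.single_le_sum (fun j _ => hg.1 j) (Finset.mem_univ i)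

lemma abs_sub_le_one_of_mem_stdSimplex {ι : Type*} [Fintype ι] {g h : ι → ℝ}
    (hg : g ∈ stdSimplex ℝ ι) (hh : h ∈ stdSimplex ℝ ι) (i : ι) : |g i - h i| ≤ 1 := by
  have := hg.1 i; have := hh.1 i
  have := le_one_of_mem_stdSimplex hg i; have := le_one_of_mem_stdSimplex hh i
  exact abs_le.2 ⟨by linarith, by linarith⟩

lemma abs_sum_mul_le_of_mem_stdSimplex {ι : Type*} [Fintype ι] {g a : ι → ℝ} {B : ℝ}
    (ha : ∀ i, |a i| ≤ B) (hg : g ∈ stdSimplex ℝ ι) : |∑ i, a i * g i| ≤ B := by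
  calc |∑ i, a i * g i| ≤ ∑ i, |a i * g i| := Finset.abs_sum_le_sum_abs _ _
    _ ≤ ∑ i, B * g i := Finset.sum_le_sum fun i _ => by
        rw [abs_mul, abs_of_nonneg (hg.1 i)]; exact mul_le_mul_of_nonneg_right (ha i) (hg.1 i)
    _ = B := by rw [← Finset.mul_sum, hg.2, mul_one]

lemma abs_sum_mul_sub_le_of_mem_stdSimplex {ι : Type*} [Fintype ι] {g h a : ι → ℝ} {B : ℝ}
    (ha : ∀ i, |a i| ≤ B) (hg : g ∈ stdSimplex ℝ ι) (hh : h ∈ stdSimplex ℝ ι) :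
    |∑ i, a i * (g i - h i)| ≤ 2 * B := by
  have h1 := abs_sum_mul_le_of_mem_stdSimplex ha hg
  have h2 := abs_sum_mul_le_of_mem_stdSimplex ha hh
  simp only [mul_sub, Finset.sum_sub_distrib]
  exact (abs_sub _ _).trans (by linarith)

/-! ### The predictive variance of a linear functional of the posterior -/

/-- The variance, for `Z ∼ p_g`, of the linear functional `∑ᵢ aᵢ g(ϑ_i ∣ Z)`. -/
noncomputable def postVar (ϑ : Fin d → ℝ) (a g : (Fin k → Fin d) → ℝ) : ℝ :=
  ∑' z : Fin k → ℕ, mixture ϑ g z * (∑ i, a i * (posterior ϑ g z i - g i)) ^ 2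

lemma postVar_nonneg (hϑ : ∀ i, 0 < ϑ i) (a : (Fin k → Fin d) → ℝ) {g : (Fin k → Fin d) → ℝ}
    (hg : g ∈ stdSimplex ℝ _) : 0 ≤ postVar ϑ a g :=
  tsum_nonneg fun z => mul_nonneg (mixture_nonneg hϑ hg z) (sq_nonneg _)

lemma postVar_le (hϑ : ∀ i, 0 < ϑ i) {a g : (Fin k → Fin d) → ℝ} {B : ℝ}
    (ha : ∀ i, |a i| ≤ B) (hg : g ∈ stdSimplex ℝ _) : postVar ϑ a g ≤ (2 * B) ^ 2 := by
  refine (le_abs_self _).trans (norm_tsum_mixture_smul_le (E := ℝ) hϑ hg fun z => ?_)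
  rw [norm_pow, Real.norm_eq_abs]
  exact pow_le_pow_left₀ (abs_nonneg _)
    (abs_sum_mul_sub_le_of_mem_stdSimplex ha (posterior_mem_stdSimplex hϑ hg z) hg) 2

/-- A linear functional of the posterior, in terms of the joint weights. -/
lemma sum_mul_posterior (a g : (Fin k → Fin d) → ℝ) (z : Fin k → ℕ) :
    ∑ i, a i * posterior ϑ g z i =
      (∑ i, poissonKernel ϑ z i * (a i * g i)) / mixture ϑ g z := by
  simp only [posterior, Finset.sum_div]
  exact Finset.sum_congr rfl fun i _ => by ring

lemma hasSum_mixture_mul_sum_posterior (hϑ : ∀ i, 0 < ϑ i) (a : (Fin k → Fin d) → ℝ)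
    {g : (Fin k → Fin d) → ℝ} (hg : g ∈ stdSimplex ℝ _) :
    HasSum (fun z => mixture ϑ g z * ∑ i, a i * posterior ϑ g z i) (∑ i, a i * g i) := by
  have h := hasSum_sum fun i (_ : i ∈ Finset.univ) =>
    (hasSum_mixture_mul_posterior hϑ hg i).mul_left (a i)
  refine h.congr_fun fun z => ?_
  rw [Finset.mul_sum]
  exact Finset.sum_congr rfl fun i _ => by ring

lemma hasSum_mixture_mul_sum_posterior_sub (hϑ : ∀ i, 0 < ϑ i) (a : (Fin k → Fin d) → ℝ)
    {g : (Fin k → Fin d) → ℝ} (hg : g ∈ stdSimplex ℝ _) :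
    HasSum (fun z => mixture ϑ g z * ∑ i, a i * (posterior ϑ g z i - g i)) 0 := by
  have h := (hasSum_mixture_mul_sum_posterior hϑ a hg).sub
    ((hasSum_mixture hϑ hg).mul_right (∑ i, a i * g i))
  simpa [mul_sub, Finset.sum_sub_distrib] using h

lemma hasSum_postVar (hϑ : ∀ i, 0 < ϑ i) (a : (Fin k → Fin d) → ℝ)
    {g : (Fin k → Fin d) → ℝ} (hg : g ∈ stdSimplex ℝ _) :
    HasSum (fun z => mixture ϑ g z * (∑ i, a i * (posterior ϑ g z i - g i)) ^ 2)
      (postVar ϑ a g) := by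
  obtain ⟨B, hB⟩ : ∃ B, ∀ i, |a i| ≤ B := (Set.finite_range fun i => |a i|).bddAbove.imp
    fun B hB i => hB ⟨i, rfl⟩
  refine (summable_mixture_smul (E := ℝ) hϑ hg (C := (2 * B) ^ 2) fun z => ?_).hasSum
  rw [norm_pow, Real.norm_eq_abs]
  exact pow_le_pow_left₀ (abs_nonneg _)
    (abs_sum_mul_sub_le_of_mem_stdSimplex hB (posterior_mem_stdSimplex hϑ hg z) hg) 2

/-- Second moment as variance plus squared mean. The uncentered form is the useful one for
continuity: its terms are `x ^ 2 / y` with `x` and `y` linear in the joint weights. -/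
lemma hasSum_sq_sum_posterior (hϑ : ∀ i, 0 < ϑ i) (a : (Fin k → Fin d) → ℝ)
    {g : (Fin k → Fin d) → ℝ} (hg : g ∈ stdSimplex ℝ _) :
    HasSum (fun z => mixture ϑ g z * (∑ i, a i * posterior ϑ g z i) ^ 2)
      (postVar ϑ a g + (∑ i, a i * g i) ^ 2) := by
  have h := ((hasSum_postVar hϑ a hg).add ((hasSum_mixture_mul_sum_posterior hϑ a hg).mul_right
    (2 * ∑ i, a i * g i))).sub ((hasSum_mixture hϑ hg).mul_right ((∑ i, a i * g i) ^ 2))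
  rw [show postVar ϑ a g + (∑ i, a i * g i) ^ 2 = postVar ϑ a g + (∑ i, a i * g i) *
    (2 * ∑ i, a i * g i) - 1 * (∑ i, a i * g i) ^ 2 by ring]
  refine h.congr_fun fun z => ?_
  simp only [mul_sub, Finset.sum_sub_distrib]
  ring

/-- The function `x ^ 2 / y` is Lipschitz on the cone `|x| ≤ B y`. -/
lemma abs_mul_sq_div_sub_le {x x' y y' B : ℝ} (hy : 0 < y) (hy' : 0 < y')
    (hx : |x / y| ≤ B) (hx' : |x' / y'| ≤ B) :
    |y * (x / y) ^ 2 - y' * (x' / y') ^ 2| ≤ 2 * B * |x - x'| + B ^ 2 * |y - y'| := by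
  set q := x / y
  set q' := x' / y'
  have e : y * q ^ 2 - y' * q' ^ 2 = (q + q') * (x - x') - q * q' * (y - y') := by
    rw [show x = q * y from (div_mul_cancel₀ _ hy.ne').symm,
      show x' = q' * y' from (div_mul_cancel₀ _ hy'.ne').symm]
    ring
  have hB : 0 ≤ B := (abs_nonneg _).trans hx
  rw [e]
  refine (abs_sub _ _).trans (add_le_add ?_ ?_)
  · rw [abs_mul]
    exact mul_le_mul_of_nonneg_right ((abs_add_le _ _).trans (by linarith)) (abs_nonneg _)
  · rw [abs_mul, abs_mul, sq]
    exact mul_le_mul_of_nonneg_right (mul_le_mul hx hx' (abs_nonneg _) hB) (abs_nonneg _)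

lemma tsum_abs_sum_poissonKernel_mul_le (hϑ : ∀ i, 0 < ϑ i) (w : (Fin k → Fin d) → ℝ) :
    Summable (fun z : Fin k → ℕ => |∑ i, poissonKernel ϑ z i * w i|) ∧
    ∑' z : Fin k → ℕ, |∑ i, poissonKernel ϑ z i * w i| ≤ ∑ i, |w i| := by
  have h := hasSum_poissonKernel_mul hϑ fun i => |w i|
  have hle (z : Fin k → ℕ) : |∑ i, poissonKernel ϑ z i * w i| ≤
      ∑ i, poissonKernel ϑ z i * |w i| :=
    (Finset.abs_sum_le_sum_abs _ _).trans_eq <| Finset.sum_congr rfl fun i _ => by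
      rw [abs_mul, abs_of_pos (poissonKernel_pos hϑ z i)]
  have hs := Summable.of_nonneg_of_le (fun z => abs_nonneg _) hle h.summable
  exact ⟨hs, (hs.tsum_le_tsum hle h.summable).trans_eq h.tsum_eq⟩

/-- Lipschitz continuity of the predictive variance, jointly in the functional and the mixing
distribution. -/
lemma abs_postVar_sub_le (hϑ : ∀ i, 0 < ϑ i) {a a' g g' : (Fin k → Fin d) → ℝ} {B : ℝ}
    (ha : ∀ i, |a i| ≤ B) (ha' : ∀ i, |a' i| ≤ B)
    (hg : g ∈ stdSimplex ℝ _) (hg' : g' ∈ stdSimplex ℝ _) :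
    |postVar ϑ a g - postVar ϑ a' g'| ≤
      5 * B ^ 2 * ∑ i, |g i - g' i| + 4 * B * ∑ i, |a i - a' i| := by
  rcases isEmpty_or_nonempty (Fin k → Fin d) with he | ⟨⟨i₀⟩⟩
  · have := hg.2; simp at this
  have hB : 0 ≤ B := (abs_nonneg _).trans (ha i₀)
  set W := ∑ i, |a i * g i - a' i * g' i|
  have hW : W ≤ B * ∑ i, |g i - g' i| + ∑ i, |a i - a' i| := by
    rw [Finset.mul_sum, ← Finset.sum_add_distrib]
    refine Finset.sum_le_sum fun i _ => ?_
    rw [show a i * g i - a' i * g' i = a i * (g i - g' i) + (a i - a' i) * g' i by ring]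
    refine (abs_add_le _ _).trans (add_le_add ?_ ?_)
    · rw [abs_mul]; exact mul_le_mul_of_nonneg_right (ha i) (abs_nonneg _)
    · rw [abs_mul, abs_of_nonneg (hg'.1 i)]
      exact mul_le_of_le_one_right (abs_nonneg _) (le_one_of_mem_stdSimplex hg' i)
  have hS := hasSum_sq_sum_posterior hϑ a hg
  have hS' := hasSum_sq_sum_posterior hϑ a' hg'
  obtain ⟨s1, h1⟩ := tsum_abs_sum_poissonKernel_mul_le hϑ fun i => a i * g i - a' i * g' i
  obtain ⟨s2, h2⟩ := tsum_abs_sum_poissonKernel_mul_le hϑ fun i => g i - g' i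
  -- Apply the Lipschitz bound on the cone to each `z`, with `x = ∑ᵢ k aᵢ gᵢ` and `y = p_g(z)`;
  -- summing over `z` then costs only `ℓ¹` distances of weights.
  have hdiff : |(postVar ϑ a g + (∑ i, a i * g i) ^ 2) -
      (postVar ϑ a' g' + (∑ i, a' i * g' i) ^ 2)| ≤ 2 * B * W + B ^ 2 * ∑ i, |g i - g' i| := by
    rw [← (hS.sub hS').tsum_eq]
    have hsum := (s1.mul_left (2 * B)).add (s2.mul_left (B ^ 2))
    rw [← Real.norm_eq_abs]
    refine (tsum_of_norm_bounded hsum.hasSum fun z => ?_).trans ?_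
    · have hx : |∑ i, a i * posterior ϑ g z i| ≤ B :=
        abs_sum_mul_le_of_mem_stdSimplex ha (posterior_mem_stdSimplex hϑ hg z)
      have hx' : |∑ i, a' i * posterior ϑ g' z i| ≤ B :=
        abs_sum_mul_le_of_mem_stdSimplex ha' (posterior_mem_stdSimplex hϑ hg' z)
      rw [sum_mul_posterior] at hx hx'
      rw [sum_mul_posterior, sum_mul_posterior, Real.norm_eq_abs]
      refine (abs_mul_sq_div_sub_le (mixture_pos hϑ hg z) (mixture_pos hϑ hg' z) hx hx').trans_eq ?_
      simp only [mixture, mul_sub, Finset.sum_sub_distrib]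
    · rw [(s1.mul_left _).tsum_add (s2.mul_left _), tsum_mul_left, tsum_mul_left]
      gcongr
  have hsq : |(∑ i, a i * g i) ^ 2 - (∑ i, a' i * g' i) ^ 2| ≤ 2 * B * W := by
    rw [sq_sub_sq, abs_mul]
    refine mul_le_mul ((abs_add_le _ _).trans ?_) ?_ (abs_nonneg _) (by positivity)
    · linarith [abs_sum_mul_le_of_mem_stdSimplex ha hg, abs_sum_mul_le_of_mem_stdSimplex ha' hg']
    · rw [← Finset.sum_sub_distrib]; exact Finset.abs_sum_le_sum_abs _ _
  rw [abs_le] at *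
  -- `W` enters with factor `2B` from the second moments and again from the squared means; `4B · B +
  -- B²` gives the constant `5B²`.
  have := mul_le_mul_of_nonneg_left hW (by positivity : 0 ≤ 4 * B)
  constructor <;> nlinarith [hdiff.1, hdiff.2, hsq.1, hsq.2]

end PoissonQB

namespace PoissonQB

variable {k d : ℕ} {ϑ : Fin d → ℝ}

/-! ### One-step characteristic functions -/

lemma norm_cexp_I_mul_sub_le {x : ℝ} (hx : |x| ≤ 1) :
    ‖Complex.exp (Complex.I * x) - (1 + Complex.I * x - (x : ℂ) ^ 2 / 2)‖ ≤ |x| ^ 3 := by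
  have hn : ‖Complex.I * x‖ = |x| := by simp
  have h := Complex.exp_bound (x := Complex.I * x) (by rwa [hn]) (n := 3) (by norm_num)
  rw [hn] at h
  have e : ∑ m ∈ Finset.range 3, (Complex.I * (x : ℂ)) ^ m / (m.factorial : ℂ) =
      1 + Complex.I * x - (x : ℂ) ^ 2 / 2 := by
    simp [Finset.sum_range_succ, mul_pow, Nat.factorial]
    ring
  rw [e] at h
  refine h.trans (mul_le_of_le_one_right (by positivity) ?_)
  norm_num [Nat.factorial]

/-- The characteristic function of the increment `∑ᵢ aᵢ (g(ϑ_i ∣ Z) - g(ϑ_i))`, for `Z ∼ p_g`, is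
close to that of a centered Gaussian variable. -/
lemma norm_tsum_mixture_cexp_sub_le (hϑ : ∀ i, 0 < ϑ i) {a g : (Fin k → Fin d) → ℝ} {B c v : ℝ}
    (ha : ∀ i, |a i| ≤ B) (hg : g ∈ stdSimplex ℝ _) (hc : 0 ≤ c) (hcB : 2 * B * c ≤ 1)
    (hv : 0 ≤ v) (hvB : v ≤ (2 * B) ^ 2) :
    ‖∑' z, mixture ϑ g z • Complex.exp
        (Complex.I * (c * ∑ i, a i * (posterior ϑ g z i - g i) : ℝ)) -
      (Real.exp (-(c ^ 2 * v / 2)) : ℂ)‖ ≤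
      2 * (2 * B * c) ^ 3 + c ^ 2 / 2 * |postVar ϑ a g - v| := by
  rcases isEmpty_or_nonempty (Fin k → Fin d) with he | ⟨⟨i₀⟩⟩
  · have := hg.2; simp at this
  have hB : 0 ≤ B := (abs_nonneg _).trans (ha i₀)
  set x : (Fin k → ℕ) → ℝ := fun z => c * ∑ i, a i * (posterior ϑ g z i - g i)
  have hx (z) : |x z| ≤ 2 * B * c := by
    rw [abs_mul, abs_of_nonneg hc, mul_comm]
    exact mul_le_mul_of_nonneg_right
      (abs_sum_mul_sub_le_of_mem_stdSimplex ha (posterior_mem_stdSimplex hϑ hg z) hg) hc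
  have h1 : HasSum (fun z => mixture ϑ g z * x z) 0 := by
    have := (hasSum_mixture_mul_sum_posterior_sub hϑ a hg).mul_left c
    rw [mul_zero] at this
    exact this.congr_fun fun z => by simp only [x]; ring
  have h2 : HasSum (fun z => mixture ϑ g z * x z ^ 2) (c ^ 2 * postVar ϑ a g) :=
    ((hasSum_postVar hϑ a hg).mul_left (c ^ 2)).congr_fun fun z => by simp only [x]; ring
  have h3 : HasSum (fun z => mixture ϑ g z • (1 + Complex.I * x z - (x z : ℂ) ^ 2 / 2))
      (1 - ((c ^ 2 * postVar ϑ a g / 2 : ℝ) : ℂ)) := by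
    have e0 := Complex.hasSum_ofReal.2 (hasSum_mixture hϑ hg)
    have e1 := (Complex.hasSum_ofReal.2 h1).mul_left Complex.I
    have e2 := (Complex.hasSum_ofReal.2 h2).div_const 2
    have e := (e0.add e1).sub e2
    push_cast at e ⊢
    rw [mul_zero, add_zero] at e
    refine e.congr_fun fun z => ?_
    rw [Complex.real_smul]
    ring
  have hE : HasSum (fun z => mixture ϑ g z • Complex.exp (Complex.I * x z))
      (∑' z, mixture ϑ g z • Complex.exp (Complex.I * x z)) :=
    (summable_mixture_smul hϑ hg (C := 1) fun z => by
      rw [mul_comm, Complex.norm_exp_ofReal_mul_I]).hasSum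
  have hd : ‖∑' z, mixture ϑ g z • Complex.exp (Complex.I * x z) -
      (1 - (c ^ 2 * postVar ϑ a g / 2 : ℝ))‖ ≤ (2 * B * c) ^ 3 := by
    rw [← (hE.sub h3).tsum_eq]
    simp only [← smul_sub]
    exact norm_tsum_mixture_smul_le hϑ hg fun z =>
      (norm_cexp_I_mul_sub_le ((hx z).trans hcB)).trans
        (pow_le_pow_left₀ (abs_nonneg _) (hx z) 3)
  have hcB0 : 0 ≤ 2 * B * c := by positivity
  have hy : c ^ 2 * v / 2 ≤ (2 * B * c) ^ 2 / 2 := by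
    have := mul_le_mul_of_nonneg_left hvB (sq_nonneg c)
    nlinarith
  have hy0 : 0 ≤ c ^ 2 * v / 2 := by positivity
  have hsq : (2 * B * c) ^ 2 ≤ 1 := pow_le_one₀ hcB0 hcB
  -- With `y = c²v/2` the remainder is at most `y² ≤ (2Bc)⁴/4`, which is absorbed into the cubic
  -- term because `2Bc ≤ 1`.
  have hr : |Real.exp (-(c ^ 2 * v / 2)) - (1 - c ^ 2 * v / 2)| ≤ (2 * B * c) ^ 3 := by
    have := Real.abs_exp_sub_one_sub_id_le (x := -(c ^ 2 * v / 2))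
      (by rw [abs_neg, abs_of_nonneg hy0]; linarith)
    rw [show Real.exp (-(c ^ 2 * v / 2)) - (1 - c ^ 2 * v / 2) =
      Real.exp (-(c ^ 2 * v / 2)) - 1 - -(c ^ 2 * v / 2) by ring]
    refine this.trans ?_
    have h4 : (2 * B * c) ^ 4 ≤ (2 * B * c) ^ 3 := pow_le_pow_of_le_one hcB0 hcB (by norm_num)
    have h5 := pow_le_pow_left₀ hy0 hy 2
    nlinarith
  -- Two Taylor remainders, each at most `(2Bc)³`, and the difference of the two second-order terms.
  have key : ∑' z, mixture ϑ g z • Complex.exp (Complex.I * x z) -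
      (Real.exp (-(c ^ 2 * v / 2)) : ℂ) =
      (∑' z, mixture ϑ g z • Complex.exp (Complex.I * x z) -
        (1 - (c ^ 2 * postVar ϑ a g / 2 : ℝ))) -
      ((Real.exp (-(c ^ 2 * v / 2)) - (1 - c ^ 2 * v / 2) : ℝ) : ℂ) -
      ((c ^ 2 / 2 * (postVar ϑ a g - v) : ℝ) : ℂ) := by
    push_cast; ring
  rw [key]
  refine (norm_sub_le _ _).trans ?_
  refine (add_le_add_left (norm_sub_le _ _) _).trans ?_
  rw [Complex.norm_real, Complex.norm_real, Real.norm_eq_abs, Real.norm_eq_abs, abs_mul,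
    abs_of_nonneg (by positivity : 0 ≤ c ^ 2 / 2)]
  linarith

/-! ### The learning model -/

lemma newton_mem_stdSimplex (hϑ : ∀ i, 0 < ϑ i) {α : ℕ → ℝ}
    (hα : ∀ n, 1 ≤ n → 0 < α n ∧ α n < 1) {g₀ : (Fin k → Fin d) → ℝ} (hg₀ : g₀ ∈ stdSimplex ℝ _)
    (y : ℕ → Fin k → ℕ) (n : ℕ) : newton ϑ α g₀ y n ∈ stdSimplex ℝ _ := by
  induction n with
  | zero => exact hg₀
  | succ n ih =>
    have h := hα (n + 1) (by omega)
    exact convex_stdSimplex ℝ _ ih (posterior_mem_stdSimplex hϑ ih (y (n + 1)))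
      (by linarith) h.1.le (by ring)

lemma measurable_mixture {Ω : Type*} {m : MeasurableSpace Ω} {g : Ω → (Fin k → Fin d) → ℝ}
    (hg : ∀ i, Measurable fun ω => g ω i) {z : Ω → Fin k → ℕ} (hz : Measurable z) :
    Measurable fun ω => mixture ϑ (g ω) (z ω) :=
  Finset.measurable_sum _ fun i _ =>
    ((measurable_of_countable fun y : Fin k → ℕ => poissonKernel ϑ y i).comp hz).mul (hg i)

lemma measurable_posterior {Ω : Type*} {m : MeasurableSpace Ω} {g : Ω → (Fin k → Fin d) → ℝ}
    (hg : ∀ i, Measurable fun ω => g ω i) {z : Ω → Fin k → ℕ} (hz : Measurable z)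
    (i : Fin k → Fin d) : Measurable fun ω => posterior ϑ (g ω) (z ω) i :=
  (((measurable_of_countable fun y : Fin k → ℕ => poissonKernel ϑ y i).comp hz).mul (hg i)).div
    (measurable_mixture hg hz)

lemma measurable_postVar {Ω : Type*} {m : MeasurableSpace Ω} {a g : Ω → (Fin k → Fin d) → ℝ}
    (ha : ∀ i, Measurable fun ω => a ω i) (hg : ∀ i, Measurable fun ω => g ω i) :
    Measurable fun ω => postVar ϑ (a ω) (g ω) :=
  Measurable.tsum fun _ => (measurable_mixture hg measurable_const).mul
    ((Finset.measurable_sum _ fun i _ =>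
      (ha i).mul ((measurable_posterior hg measurable_const i).sub (hg i))).pow_const 2)

variable {Ω : Type*} {mΩ : MeasurableSpace Ω} {μ : Measure Ω}
  {α : ℕ → ℝ} {g₀ : (Fin k → Fin d) → ℝ} {Y : ℕ → Ω → Fin k → ℕ} {hY : ∀ n, Measurable (Y n)}

lemma measurable_obs {m n : ℕ} (hm : 1 ≤ m) (hmn : m ≤ n) :
    Measurable[obsFiltration Y hY n] (Y m) :=
  Measurable.of_comap_le (le_iSup₂_of_le (f := fun m (_ : m ∈ Finset.Icc 1 n) =>
    MeasurableSpace.comap (Y m) inferInstance) m (Finset.mem_Icc.2 ⟨hm, hmn⟩) le_rfl)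

lemma measurable_newton (n : ℕ) (i : Fin k → Fin d) :
    Measurable[obsFiltration Y hY n] fun ω => newton ϑ α g₀ (fun m => Y m ω) n i := by
  induction n generalizing i with
  | zero => exact measurable_const
  | succ n ih =>
    have h (i) : Measurable[obsFiltration Y hY (n + 1)]
        fun ω => newton ϑ α g₀ (fun m => Y m ω) n i :=
      (ih i).mono ((obsFiltration Y hY).mono n.le_succ) le_rfl
    exact ((h i).const_mul _).add ((measurable_posterior h
      (measurable_obs (by omega) le_rfl) i).const_mul _)

/-- The standing assumptions on the learning model. -/
structure NewtonModel (μ : Measure Ω) (ϑ : Fin d → ℝ) (α : ℕ → ℝ) (g₀ : (Fin k → Fin d) → ℝ)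
    (Y : ℕ → Ω → Fin k → ℕ) (hY : ∀ n, Measurable (Y n)) : Prop where
  grid_pos : ∀ i, 0 < ϑ i
  rate : ∀ n, 1 ≤ n → 0 < α n ∧ α n < 1
  init_mem : g₀ ∈ stdSimplex ℝ _
  model : IsLearningModel μ ϑ α g₀ Y hY
  summable_sq : Summable fun n : ℕ => α (n + 1) ^ 2

/-- The random mixing distribution `g_n`. -/
noncomputable abbrev mixSeq (ϑ : Fin d → ℝ) (α : ℕ → ℝ) (g₀ : (Fin k → Fin d) → ℝ)
    (Y : ℕ → Ω → Fin k → ℕ) (n : ℕ) (ω : Ω) : (Fin k → Fin d) → ℝ :=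
  newton ϑ α g₀ (fun m => Y m ω) n

namespace NewtonModel

variable (h : NewtonModel μ ϑ α g₀ Y hY)
include h

lemma mem_stdSimplex (n : ℕ) (ω : Ω) : mixSeq ϑ α g₀ Y n ω ∈ stdSimplex ℝ _ :=
  newton_mem_stdSimplex h.grid_pos h.rate h.init_mem _ n

variable [IsProbabilityMeasure μ]

/-- Integration of the next observation against its predictive distribution. -/
lemma integral_next {E : Type*} [NormedAddCommGroup E] [NormedSpace ℝ E] [CompleteSpace E]
    (n : ℕ) {Φ : Ω → (Fin k → ℕ) → E} {C : ℝ}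
    (hΦ : ∀ z, StronglyMeasurable[obsFiltration Y hY n] fun ω => Φ ω z)
    (hC : ∀ ω z, ‖Φ ω z‖ ≤ C) :
    ∫ ω, Φ ω (Y (n + 1) ω) ∂μ =
      ∫ ω, ∑' z, mixture ϑ (mixSeq ϑ α g₀ Y n ω) z • Φ ω z ∂μ := by
  set 𝒢 := obsFiltration Y hY
  have hΦ' (z) : AEStronglyMeasurable (fun ω => Φ ω z) μ :=
    ((hΦ z).mono (𝒢.le n)).aestronglyMeasurable
  have hmeas (z) : MeasurableSet (Y (n + 1) ⁻¹' {z}) := hY _ (measurableSet_singleton z)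
  have hind (z) : Integrable ((Y (n + 1) ⁻¹' {z}).indicator (fun _ => (1 : ℝ))) μ :=
    (integrable_const 1).indicator (hmeas z)
  have hmix_meas (z) : Measurable fun ω => mixture ϑ (mixSeq ϑ α g₀ Y n ω) z :=
    measurable_mixture (fun i => (measurable_newton n i).mono (𝒢.le n) le_rfl) measurable_const
  have hmix_le (z ω) : ‖mixture ϑ (mixSeq ϑ α g₀ Y n ω) z‖ ≤ 1 := by
    have hg := h.mem_stdSimplex n ω
    rw [Real.norm_of_nonneg (mixture_nonneg h.grid_pos hg z)]
    exact le_hasSum (hasSum_mixture h.grid_pos hg) z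
      fun _ _ => mixture_nonneg h.grid_pos hg _
  have hmix (z) : Integrable (fun ω => mixture ϑ (mixSeq ϑ α g₀ Y n ω) z) μ :=
    Integrable.of_bound (hmix_meas z).aestronglyMeasurable 1 (ae_of_all _ (hmix_le z))
  have hi1 (z) : Integrable (fun ω => (Y (n + 1) ⁻¹' {z}).indicator (fun _ => (1 : ℝ)) ω • Φ ω z) μ :=
    (hind z).smul_bdd C (hΦ' z) (ae_of_all _ fun ω => hC ω z)
  have hi2 (z) : Integrable (fun ω => mixture ϑ (mixSeq ϑ α g₀ Y n ω) z • Φ ω z) μ :=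
    (hmix z).smul_bdd C (hΦ' z) (ae_of_all _ fun ω => hC ω z)
  -- `Φ · z` is `𝒢 n`-measurable, so it can be taken out of the conditional expectation of the
  -- indicator of `Y (n + 1) = z`.
  have hstep (z) : ∫ ω, (Y (n + 1) ⁻¹' {z}).indicator (fun _ => (1 : ℝ)) ω • Φ ω z ∂μ =
      ∫ ω, mixture ϑ (mixSeq ϑ α g₀ Y n ω) z • Φ ω z ∂μ := by
    rw [← integral_condExp (𝒢.le n)]
    refine integral_congr_ae ?_
    have e := condExp_smul_of_aestronglyMeasurable_right (m := 𝒢 n) (hind z) (hi1 z)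
      (hΦ z).aestronglyMeasurable
    filter_upwards [e, h.model n z] with ω h1 h2
    exact h1.trans (by rw [Pi.smul_apply', h2])
  have hprob (z) : ∫ ω, mixture ϑ (mixSeq ϑ α g₀ Y n ω) z ∂μ = μ.real (Y (n + 1) ⁻¹' {z}) := by
    rw [← integral_congr_ae (h.model n z), integral_condExp (𝒢.le n), integral_indicator (hmeas z)]
    simp
  have hsum : Summable fun z => μ.real (Y (n + 1) ⁻¹' {z}) := by
    refine ENNReal.summable_toReal ?_
    rw [← measure_iUnion (fun a b hab => Disjoint.preimage _ (by simpa using hab)) hmeas]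
    exact measure_ne_top _ _
  have hpt (ω) : Φ ω (Y (n + 1) ω) =
      ∑' z, (Y (n + 1) ⁻¹' {z}).indicator (fun _ => (1 : ℝ)) ω • Φ ω z := by
    rw [tsum_eq_single (Y (n + 1) ω) fun z hz => ?_]
    · simp
    · rw [Set.indicator_of_notMem (by simpa using hz.symm), zero_smul]
  simp only [hpt]
  have hb (z) (f : Ω → ℝ) (hf : ∀ ω, 0 ≤ f ω) (hfi : Integrable f μ)
      (hfe : ∫ ω, f ω ∂μ = μ.real (Y (n + 1) ⁻¹' {z})) :
      ∫ ω, ‖f ω • Φ ω z‖ ∂μ ≤ μ.real (Y (n + 1) ⁻¹' {z}) * C := by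
    rw [← hfe, ← integral_mul_const]
    refine integral_mono (hfi.smul_bdd C (hΦ' z) (ae_of_all _ fun ω => hC ω z)).norm
      (hfi.mul_const C) fun ω => ?_
    rw [norm_smul, Real.norm_of_nonneg (hf ω)]
    exact mul_le_mul_of_nonneg_left (hC ω z) (hf ω)
  -- Sum and integral may be exchanged on both sides: the `z`-th norm integrates to at most `C`
  -- times the probability of `Y (n + 1) = z`, which is summable.
  rw [← integral_tsum_of_summable_integral_norm hi1, ← integral_tsum_of_summable_integral_norm hi2]
  · exact tsum_congr hstep
  · exact Summable.of_nonneg_of_le (fun z => integral_nonneg fun ω => norm_nonneg _)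
      (fun z => hb z _ (fun ω => mixture_nonneg h.grid_pos (h.mem_stdSimplex n ω) z) (hmix z)
        (hprob z)) (hsum.mul_right C)
  · refine Summable.of_nonneg_of_le (fun z => integral_nonneg fun ω => norm_nonneg _)
      (fun z => hb z _ (fun ω => Set.indicator_nonneg (fun _ _ => zero_le_one) ω) (hind z) ?_)
      (hsum.mul_right C)
    rw [integral_indicator (hmeas z)]
    simp

/-- The indicator of `A` can be absorbed into `Φ` without losing measurability or boundedness.
Conditional statements are handled below through such integrals over `A`. -/
lemma setIntegral_next {E : Type*} [NormedAddCommGroup E] [NormedSpace ℝ E] [CompleteSpace E]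
    (n : ℕ) {Φ : Ω → (Fin k → ℕ) → E} {C : ℝ}
    (hΦ : ∀ z, StronglyMeasurable[obsFiltration Y hY n] fun ω => Φ ω z)
    (hC : ∀ ω z, ‖Φ ω z‖ ≤ C) {A : Set Ω} (hA : MeasurableSet[obsFiltration Y hY n] A) :
    ∫ ω in A, Φ ω (Y (n + 1) ω) ∂μ =
      ∫ ω in A, ∑' z, mixture ϑ (mixSeq ϑ α g₀ Y n ω) z • Φ ω z ∂μ := by
  have hA' := (obsFiltration Y hY).le n _ hA
  have e := h.integral_next n (Φ := fun ω z => A.indicator (fun ω => Φ ω z) ω)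
    (C := C) (fun z => (hΦ z).indicator hA) fun ω z => (norm_indicator_le_norm_self _ _).trans (hC ω z)
  rw [← integral_indicator hA', ← integral_indicator hA']
  refine (integral_congr_ae (ae_of_all _ fun ω => ?_)).trans
    (e.trans (integral_congr_ae (ae_of_all _ fun ω => ?_)))
  all_goals by_cases hω : ω ∈ A <;> simp [hω]

end NewtonModel
end PoissonQB

/-! ### Martingale convergence of the mixing distributions and conditional moment bounds -/

namespace PoissonQB

variable {k d : ℕ} {ϑ : Fin d → ℝ}

lemma measurable_sum_mul_sub {Ω : Type*} {m : MeasurableSpace Ω} {a g g' : Ω → (Fin k → Fin d) → ℝ}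
    (ha : ∀ i, Measurable fun ω => a ω i) (hg : ∀ i, Measurable fun ω => g ω i)
    (hg' : ∀ i, Measurable fun ω => g' ω i) :
    Measurable fun ω => ∑ i, a ω i * (g ω i - g' ω i) :=
  Finset.measurable_sum _ fun i _ => (ha i).mul ((hg i).sub (hg' i))

lemma norm_cexp_I_mul_ofReal (x : ℝ) : ‖Complex.exp (Complex.I * x)‖ = 1 := by
  rw [mul_comm, Complex.norm_exp_ofReal_mul_I]

lemma norm_cexp_I_mul_mul_exp_neg_le (x : ℝ) {y : ℝ} (hy : 0 ≤ y) :
    ‖Complex.exp (Complex.I * x) * (Real.exp (-y) : ℂ)‖ ≤ 1 := by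
  rw [norm_mul, norm_cexp_I_mul_ofReal, one_mul, Complex.norm_real,
    Real.norm_of_nonneg (Real.exp_pos _).le]
  exact Real.exp_le_one_iff.2 (by linarith)

/-- The tail `∑_{m > n} α_m ^ 2`. -/
noncomputable def tailSq (α : ℕ → ℝ) (n : ℕ) : ℝ := ∑' m : ℕ, α (n + m + 1) ^ 2

variable {Ω : Type*} {mΩ : MeasurableSpace Ω} {μ : Measure Ω}
  {α : ℕ → ℝ} {g₀ : (Fin k → Fin d) → ℝ} {Y : ℕ → Ω → Fin k → ℕ} {hY : ∀ n, Measurable (Y n)}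

/-- The random limit `g̃`. -/
noncomputable abbrev mixLim (ϑ : Fin d → ℝ) (α : ℕ → ℝ) (g₀ : (Fin k → Fin d) → ℝ)
    (Y : ℕ → Ω → Fin k → ℕ) (ω : Ω) : (Fin k → Fin d) → ℝ :=
  newtonLimit ϑ α g₀ fun m => Y m ω

lemma mixSeq_succ (n : ℕ) (ω : Ω) (i : Fin k → Fin d) :
    mixSeq ϑ α g₀ Y (n + 1) ω i = mixSeq ϑ α g₀ Y n ω i +
      α (n + 1) * (posterior ϑ (mixSeq ϑ α g₀ Y n ω) (Y (n + 1) ω) i - mixSeq ϑ α g₀ Y n ω i) := by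
  simp only [mixSeq, newton]; ring

lemma measurable_mixSeq_of_le {n N : ℕ} (hnN : n ≤ N) (i : Fin k → Fin d) :
    Measurable[obsFiltration Y hY N] fun ω => mixSeq ϑ α g₀ Y n ω i :=
  (measurable_newton n i).mono ((obsFiltration Y hY).mono hnN) le_rfl

lemma measurable_mixSeq (hY : ∀ n, Measurable (Y n)) (n : ℕ) (i : Fin k → Fin d) :
    Measurable fun ω => mixSeq ϑ α g₀ Y n ω i :=
  (measurable_newton n i).mono ((obsFiltration Y hY).le n) le_rfl

lemma measurable_mixLim (hY : ∀ n, Measurable (Y n)) (i : Fin k → Fin d) :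
    Measurable fun ω => mixLim ϑ α g₀ Y ω i :=
  (StronglyMeasurable.limUnder fun n => (measurable_mixSeq hY n i).stronglyMeasurable).measurable

/-- Integrate `|f| ≤ s/2 + f²/(2s)` with the optimal `s = √R`; this passes from conditional second
moments to conditional first moments. -/
lemma setIntegral_abs_le_sqrt_mul [IsFiniteMeasure μ] {f : Ω → ℝ} (hf : Integrable f μ)
    (hf2 : Integrable (fun ω => f ω ^ 2) μ) {R : ℝ} (hR : 0 < R) {A : Set Ω}
    (hle : ∫ ω in A, f ω ^ 2 ∂μ ≤ R * μ.real A) : ∫ ω in A, |f ω| ∂μ ≤ √R * μ.real A := by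
  have hs : 0 < √R := Real.sqrt_pos.2 hR
  have hss := Real.sq_sqrt hR.le
  set s := √R
  calc _ ≤ ∫ ω in A, (s / 2 + f ω ^ 2 / (2 * s)) ∂μ := by
        refine integral_mono hf.abs.integrableOn
          ((integrable_const _).add (hf2.div_const _).integrableOn) fun ω => ?_
        have e : s / 2 + |f ω| ^ 2 / (2 * s) - |f ω| = (s - |f ω|) ^ 2 / (2 * s) := by
          field_simp; ring
        have : 0 ≤ (s - |f ω|) ^ 2 / (2 * s) := by positivity
        change |f ω| ≤ s / 2 + f ω ^ 2 / (2 * s)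
        rw [← sq_abs]
        linarith
    _ = s / 2 * μ.real A + (∫ ω in A, f ω ^ 2 ∂μ) / (2 * s) := by
        rw [integral_add (integrable_const _) (hf2.div_const _).integrableOn, setIntegral_const,
          integral_div, smul_eq_mul, mul_comm]
    _ ≤ s / 2 * μ.real A + s ^ 2 * μ.real A / (2 * s) := by
        rw [hss]
        gcongr
    _ = s * μ.real A := by field_simp; ring

namespace NewtonModel

variable (h : NewtonModel μ ϑ α g₀ Y hY)
include h

lemma summable_tail (n : ℕ) : Summable fun m : ℕ => α (n + m + 1) ^ 2 := by
  simpa [add_comm, add_left_comm] using (summable_nat_add_iff n).2 h.summable_sq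

lemma tailSq_pos (n : ℕ) : 0 < tailSq α n :=
  (h.summable_tail n).tsum_pos (fun _ => sq_nonneg _) 0 (by
    have := (h.rate (n + 0 + 1) (by omega)).1; positivity)

lemma sum_Ico_le_tailSq (n N : ℕ) : ∑ l ∈ Finset.Ico n N, α (l + 1) ^ 2 ≤ tailSq α n := by
  rw [Finset.sum_Ico_eq_sum_range]
  exact (h.summable_tail n).sum_le_tsum _ fun _ _ => sq_nonneg _

lemma tendsto_sum_Ico (n : ℕ) :
    Tendsto (fun N => ∑ l ∈ Finset.Ico n N, α (l + 1) ^ 2) atTop (𝓝 (tailSq α n)) := by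
  simp only [Finset.sum_Ico_eq_sum_range]
  exact (h.summable_tail n).hasSum.tendsto_sum_nat.comp (tendsto_sub_atTop_nat n)

variable [IsProbabilityMeasure μ]

omit [IsProbabilityMeasure μ] in
lemma norm_mixSeq_le (n : ℕ) (ω : Ω) (i : Fin k → Fin d) : ‖mixSeq ϑ α g₀ Y n ω i‖ ≤ 1 := by
  have hg := h.mem_stdSimplex n ω
  rw [Real.norm_of_nonneg (hg.1 i)]
  exact le_one_of_mem_stdSimplex hg i

lemma integrable_mixSeq (n : ℕ) (i : Fin k → Fin d) :
    Integrable (fun ω => mixSeq ϑ α g₀ Y n ω i) μ :=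
  Integrable.of_bound (measurable_mixSeq hY n i).aestronglyMeasurable 1
    (ae_of_all _ fun ω => h.norm_mixSeq_le n ω i)

lemma setIntegral_mixSeq_succ (n : ℕ) (i : Fin k → Fin d) {A : Set Ω}
    (hA : MeasurableSet[obsFiltration Y hY n] A) :
    ∫ ω in A, mixSeq ϑ α g₀ Y n ω i ∂μ = ∫ ω in A, mixSeq ϑ α g₀ Y (n + 1) ω i ∂μ := by
  have hα := h.rate (n + 1) (by omega)
  have e := h.setIntegral_next n (E := ℝ) (C := 2) (Φ := fun ω z => mixSeq ϑ α g₀ Y n ω i +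
    α (n + 1) * (posterior ϑ (mixSeq ϑ α g₀ Y n ω) z i - mixSeq ϑ α g₀ Y n ω i))
    (fun z => ((measurable_newton n i).add (((measurable_posterior (measurable_newton n)
      measurable_const i).sub (measurable_newton n i)).const_mul _)).stronglyMeasurable)
    (fun ω z => by
      have hg := h.mem_stdSimplex n ω
      have h1 := h.norm_mixSeq_le n ω i
      have h2 := abs_sub_le_one_of_mem_stdSimplex (posterior_mem_stdSimplex h.grid_pos hg z) hg i
      refine (norm_add_le _ _).trans ?_
      rw [norm_mul, Real.norm_of_nonneg hα.1.le, Real.norm_eq_abs (_ - _)]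
      nlinarith [abs_nonneg (posterior ϑ (mixSeq ϑ α g₀ Y n ω) z i - mixSeq ϑ α g₀ Y n ω i)]) hA
  simp only [mixSeq_succ]
  rw [e]
  refine integral_congr_ae (ae_of_all _ fun ω => ?_)
  have hg := h.mem_stdSimplex n ω
  have s1 := (hasSum_mixture h.grid_pos hg).mul_right (mixSeq ϑ α g₀ Y n ω i)
  have s2 := (hasSum_mixture_mul_posterior h.grid_pos hg i)
  have s := s1.add ((s2.sub s1).mul_left (α (n + 1)))
  rw [one_mul, sub_self, mul_zero, add_zero] at s
  exact (s.congr_fun fun z => by rw [smul_eq_mul]; ring).tsum_eq.symm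

lemma martingale (i : Fin k → Fin d) :
    Martingale (fun n ω => mixSeq ϑ α g₀ Y n ω i) (obsFiltration Y hY) μ :=
  martingale_of_setIntegral_eq_succ (fun n => (measurable_newton n i).stronglyMeasurable)
    (fun n => h.integrable_mixSeq n i) fun n _ hA => h.setIntegral_mixSeq_succ n i hA

/-- Doob's theorem for a bounded martingale. Since `newtonLimit` is a `limUnder`, existence of a
limit is all that is needed. -/
lemma ae_tendsto_mixLim :
    ∀ᵐ ω ∂μ, ∀ i, Tendsto (fun n => mixSeq ϑ α g₀ Y n ω i) atTop (𝓝 (mixLim ϑ α g₀ Y ω i)) := by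
  rw [ae_all_iff]
  intro i
  have hb (n : ℕ) : eLpNorm (fun ω => mixSeq ϑ α g₀ Y n ω i) 1 μ ≤ (1 : NNReal) := by
    refine (eLpNorm_le_of_ae_bound (C := 1) (ae_of_all _ fun ω => h.norm_mixSeq_le n ω i)).trans ?_
    simp
  filter_upwards [(h.martingale i).submartingale.exists_ae_tendsto_of_bdd hb] with ω hω
  exact tendsto_nhds_limUnder hω

lemma ae_mixLim_mem : ∀ᵐ ω ∂μ, mixLim ϑ α g₀ Y ω ∈ stdSimplex ℝ _ := by
  filter_upwards [h.ae_tendsto_mixLim] with ω hω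
  exact (isClosed_stdSimplex _ _).mem_of_tendsto (tendsto_pi_nhds.2 hω)
    (Eventually.of_forall fun n => h.mem_stdSimplex n ω)

omit [IsProbabilityMeasure μ] in
lemma abs_mixSeq_sub_le (N n : ℕ) (ω : Ω) (i : Fin k → Fin d) :
    |mixSeq ϑ α g₀ Y N ω i - mixSeq ϑ α g₀ Y n ω i| ≤ 1 :=
  abs_sub_le_one_of_mem_stdSimplex (h.mem_stdSimplex N ω) (h.mem_stdSimplex n ω) i

lemma integrable_sq_sub (N n : ℕ) (i : Fin k → Fin d) :
    Integrable (fun ω => (mixSeq ϑ α g₀ Y N ω i - mixSeq ϑ α g₀ Y n ω i) ^ 2) μ :=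
  Integrable.of_bound
    (((measurable_mixSeq hY N i).sub (measurable_mixSeq hY n i)).pow_const 2).aestronglyMeasurable 1
    (ae_of_all _ fun ω => by
      rw [norm_pow]; exact pow_le_one₀ (norm_nonneg _) (h.abs_mixSeq_sub_le N n ω i))

lemma integrable_abs_sub (N n : ℕ) (i : Fin k → Fin d) :
    Integrable (fun ω => |mixSeq ϑ α g₀ Y N ω i - mixSeq ϑ α g₀ Y n ω i|) μ :=
  ((h.integrable_mixSeq N i).sub (h.integrable_mixSeq n i)).abs

/-- Martingale increments are orthogonal, also after restriction to `A ∈ 𝒢 n`, and the one at step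
`l + 1` has conditional variance at most `α (l + 1) ^ 2`. -/
lemma setIntegral_sq_sub_le {n N : ℕ} (hnN : n ≤ N) (i : Fin k → Fin d) {A : Set Ω}
    (hA : MeasurableSet[obsFiltration Y hY n] A) :
    ∫ ω in A, (mixSeq ϑ α g₀ Y N ω i - mixSeq ϑ α g₀ Y n ω i) ^ 2 ∂μ ≤
      (∑ l ∈ Finset.Ico n N, α (l + 1) ^ 2) * μ.real A := by
  induction N, hnN using Nat.le_induction with
  | base => simp
  | succ N hnN ih =>
    have hα := h.rate (N + 1) (by omega)
    have hAN := (obsFiltration Y hY).mono hnN _ hA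
    have hA' := (obsFiltration Y hY).le n _ hA
    have hmN := fun i => measurable_mixSeq_of_le (ϑ := ϑ) (α := α) (g₀ := g₀) (hY := hY) (le_refl N) i
    have hmn := measurable_mixSeq_of_le (ϑ := ϑ) (α := α) (g₀ := g₀) (hY := hY) hnN i
    have e := h.setIntegral_next N (E := ℝ) (C := 4) (Φ := fun ω z => (mixSeq ϑ α g₀ Y N ω i +
      α (N + 1) * (posterior ϑ (mixSeq ϑ α g₀ Y N ω) z i - mixSeq ϑ α g₀ Y N ω i) -
        mixSeq ϑ α g₀ Y n ω i) ^ 2)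
      (fun z => (((hmN i).add (((measurable_posterior hmN
        measurable_const i).sub (hmN i)).const_mul _)).sub hmn |>.pow_const 2).stronglyMeasurable)
      (fun ω z => by
        have hg := h.mem_stdSimplex N ω
        have h1 := h.abs_mixSeq_sub_le N n ω i
        have h2 := abs_sub_le_one_of_mem_stdSimplex (posterior_mem_stdSimplex h.grid_pos hg z) hg i
        rw [norm_pow, show (4 : ℝ) = 2 ^ 2 by norm_num]
        refine pow_le_pow_left₀ (norm_nonneg _) ?_ 2
        rw [add_sub_right_comm]
        refine (norm_add_le _ _).trans ?_
        rw [norm_mul, Real.norm_of_nonneg hα.1.le, Real.norm_eq_abs, Real.norm_eq_abs]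
        nlinarith [abs_nonneg (posterior ϑ (mixSeq ϑ α g₀ Y N ω) z i - mixSeq ϑ α g₀ Y N ω i)]) hAN
    simp only [mixSeq_succ]
    rw [e, Finset.sum_Ico_succ_top hnN, add_mul]
    -- Expand `(D + α ξ)²`, with `ξ` the posterior minus the prior weight: the cross term has
    -- predictive mean zero, and `ξ² ≤ 1`.
    have hle (ω : Ω) : ∑' z, mixture ϑ (mixSeq ϑ α g₀ Y N ω) z • (mixSeq ϑ α g₀ Y N ω i +
      α (N + 1) * (posterior ϑ (mixSeq ϑ α g₀ Y N ω) z i - mixSeq ϑ α g₀ Y N ω i) -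
        mixSeq ϑ α g₀ Y n ω i) ^ 2 ≤
        (mixSeq ϑ α g₀ Y N ω i - mixSeq ϑ α g₀ Y n ω i) ^ 2 + α (N + 1) ^ 2 := by
      have hg := h.mem_stdSimplex N ω
      set x := mixSeq ϑ α g₀ Y N ω i
      set D := x - mixSeq ϑ α g₀ Y n ω i
      have s0 := hasSum_mixture h.grid_pos hg
      have s2 := (hasSum_mixture_mul_posterior h.grid_pos hg i).sub (s0.mul_right x)
      have s := (s0.mul_right (D ^ 2 + α (N + 1) ^ 2)).add (s2.mul_left (2 * D * α (N + 1)))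
      rw [one_mul, one_mul, sub_self, mul_zero, add_zero] at s
      refine hasSum_le (fun z => ?_) (summable_mixture_smul (E := ℝ) h.grid_pos hg (C := 4)
        fun z => ?_).hasSum s
      · have h2 := abs_sub_le_one_of_mem_stdSimplex (posterior_mem_stdSimplex h.grid_pos hg z) hg i
        have h3 : (posterior ϑ (mixSeq ϑ α g₀ Y N ω) z i - x) ^ 2 ≤ 1 := by
          rw [← sq_abs]; exact pow_le_one₀ (abs_nonneg _) h2
        have h4 := mixture_nonneg h.grid_pos hg z
        have h5 := mul_le_mul_of_nonneg_left (mul_le_mul_of_nonneg_left h3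
          (sq_nonneg (α (N + 1)))) h4
        rw [smul_eq_mul, show x + α (N + 1) * (posterior ϑ (mixSeq ϑ α g₀ Y N ω) z i - x) -
          mixSeq ϑ α g₀ Y n ω i = D + α (N + 1) * (posterior ϑ (mixSeq ϑ α g₀ Y N ω) z i - x) by
          simp only [D]; ring]
        linarith
      · have h1 := h.abs_mixSeq_sub_le N n ω i
        have h2 := abs_sub_le_one_of_mem_stdSimplex (posterior_mem_stdSimplex h.grid_pos hg z) hg i
        rw [norm_pow, show (4 : ℝ) = 2 ^ 2 by norm_num]
        refine pow_le_pow_left₀ (norm_nonneg _) ?_ 2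
        rw [add_sub_right_comm]
        refine (norm_add_le _ _).trans ?_
        rw [norm_mul, Real.norm_of_nonneg hα.1.le, Real.norm_eq_abs, Real.norm_eq_abs]
        nlinarith [abs_nonneg (posterior ϑ (mixSeq ϑ α g₀ Y N ω) z i - mixSeq ϑ α g₀ Y N ω i)]
    calc _ ≤ ∫ ω in A, ((mixSeq ϑ α g₀ Y N ω i - mixSeq ϑ α g₀ Y n ω i) ^ 2 + α (N + 1) ^ 2) ∂μ :=
          integral_mono_of_nonneg (ae_of_all _ fun ω => tsum_nonneg fun z =>
            mul_nonneg (mixture_nonneg h.grid_pos (h.mem_stdSimplex N ω) z) (sq_nonneg _))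
            (Integrable.add (μ := μ.restrict A) (h.integrable_sq_sub N n i).integrableOn
              (integrable_const _)) (ae_of_all _ hle)
      _ ≤ _ := by
        rw [integral_add (h.integrable_sq_sub N n i).integrableOn (integrable_const _),
          setIntegral_const, smul_eq_mul, mul_comm (μ.real A)]
        gcongr

lemma setIntegral_sq_sub_le_tailSq {n N : ℕ} (hnN : n ≤ N) (i : Fin k → Fin d) {A : Set Ω}
    (hA : MeasurableSet[obsFiltration Y hY n] A) :
    ∫ ω in A, (mixSeq ϑ α g₀ Y N ω i - mixSeq ϑ α g₀ Y n ω i) ^ 2 ∂μ ≤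
      tailSq α n * μ.real A :=
  (h.setIntegral_sq_sub_le hnN i hA).trans
    (mul_le_mul_of_nonneg_right (h.sum_Ico_le_tailSq n N) measureReal_nonneg)

lemma setIntegral_abs_sub_le {n N : ℕ} (hnN : n ≤ N) (i : Fin k → Fin d) {A : Set Ω}
    (hA : MeasurableSet[obsFiltration Y hY n] A) :
    ∫ ω in A, |mixSeq ϑ α g₀ Y N ω i - mixSeq ϑ α g₀ Y n ω i| ∂μ ≤
      √(tailSq α n) * μ.real A :=
  setIntegral_abs_le_sqrt_mul ((h.integrable_mixSeq N i).sub (h.integrable_mixSeq n i))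
    (h.integrable_sq_sub N n i) (h.tailSq_pos n) (h.setIntegral_sq_sub_le_tailSq hnN i hA)

/-- The bound at time `N` is uniform in `N`, so it passes to the limit by dominated convergence. -/
lemma setIntegral_sq_mixLim_sub_le (n : ℕ) (i : Fin k → Fin d) {A : Set Ω}
    (hA : MeasurableSet[obsFiltration Y hY n] A) :
    ∫ ω in A, (mixLim ϑ α g₀ Y ω i - mixSeq ϑ α g₀ Y n ω i) ^ 2 ∂μ ≤ tailSq α n * μ.real A := by
  refine le_of_tendsto (tendsto_integral_filter_of_norm_le_const (μ := μ.restrict A)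
    (F := fun N ω => (mixSeq ϑ α g₀ Y N ω i - mixSeq ϑ α g₀ Y n ω i) ^ 2)
    (Eventually.of_forall fun N => (h.integrable_sq_sub N n i).aestronglyMeasurable.restrict)
    ⟨1, Eventually.of_forall fun N => ae_of_all _ fun ω => ?_⟩ (ae_restrict_of_ae ?_))
    (eventually_atTop.2 ⟨n, fun N hN => h.setIntegral_sq_sub_le_tailSq hN i hA⟩)
  · rw [norm_pow]; exact pow_le_one₀ (norm_nonneg _) (h.abs_mixSeq_sub_le N n ω i)
  · filter_upwards [h.ae_tendsto_mixLim] with ω hω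
    exact ((hω i).sub_const _).pow 2

lemma integrable_mixLim_sub (n : ℕ) (i : Fin k → Fin d) :
    Integrable (fun ω => mixLim ϑ α g₀ Y ω i - mixSeq ϑ α g₀ Y n ω i) μ :=
  Integrable.of_bound
    ((measurable_mixLim hY i).sub (measurable_mixSeq hY n i)).aestronglyMeasurable 1
    (h.ae_mixLim_mem.mono fun ω hω => abs_sub_le_one_of_mem_stdSimplex hω (h.mem_stdSimplex n ω) i)

lemma integrable_sq_mixLim_sub (n : ℕ) (i : Fin k → Fin d) :
    Integrable (fun ω => (mixLim ϑ α g₀ Y ω i - mixSeq ϑ α g₀ Y n ω i) ^ 2) μ :=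
  Integrable.of_bound
    (((measurable_mixLim hY i).sub (measurable_mixSeq hY n i)).pow_const 2).aestronglyMeasurable 1
    (h.ae_mixLim_mem.mono fun ω hω => by
      rw [norm_pow]
      exact pow_le_one₀ (norm_nonneg _)
        (abs_sub_le_one_of_mem_stdSimplex hω (h.mem_stdSimplex n ω) i))

lemma setIntegral_abs_mixLim_sub_le (n : ℕ) (i : Fin k → Fin d) {A : Set Ω}
    (hA : MeasurableSet[obsFiltration Y hY n] A) :
    ∫ ω in A, |mixLim ϑ α g₀ Y ω i - mixSeq ϑ α g₀ Y n ω i| ∂μ ≤ √(tailSq α n) * μ.real A :=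
  setIntegral_abs_le_sqrt_mul (h.integrable_mixLim_sub n i) (h.integrable_sq_mixLim_sub n i)
    (h.tailSq_pos n) (h.setIntegral_sq_mixLim_sub_le n i hA)

end NewtonModel
end PoissonQB

/-! ### Step-by-step replacement of increments by Gaussian factors -/

namespace PoissonQB

variable {k d : ℕ} {ϑ : Fin d → ℝ} {Ω : Type*} {mΩ : MeasurableSpace Ω} {μ : Measure Ω}
  {α : ℕ → ℝ} {g₀ : (Fin k → Fin d) → ℝ} {Y : ℕ → Ω → Fin k → ℕ} {hY : ∀ n, Measurable (Y n)}

/-- The interpolation between the characteristic function of a Gaussian variable and that of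
`β ∑ᵢ aᵢ (g_N(ϑ_i) - g_n(ϑ_i))`. -/
noncomputable def interp (ϑ : Fin d → ℝ) (α : ℕ → ℝ) (g₀ : (Fin k → Fin d) → ℝ)
    (Y : ℕ → Ω → Fin k → ℕ) (a : Ω → (Fin k → Fin d) → ℝ) (β : ℝ) (n N : ℕ) (ω : Ω) : ℂ :=
  Complex.exp (Complex.I *
      (β * ∑ i, a ω i * (mixSeq ϑ α g₀ Y N ω i - mixSeq ϑ α g₀ Y n ω i) : ℝ)) *
    (Real.exp (-(β ^ 2 * postVar ϑ (a ω) (mixSeq ϑ α g₀ Y n ω) *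
      (tailSq α n - ∑ l ∈ Finset.Ico n N, α (l + 1) ^ 2) / 2)) : ℂ)

namespace NewtonModel

variable (h : NewtonModel μ ϑ α g₀ Y hY)
include h

lemma norm_interp_le (a : Ω → (Fin k → Fin d) → ℝ) (β : ℝ) (n N : ℕ) (ω : Ω) :
    ‖interp ϑ α g₀ Y a β n N ω‖ ≤ 1 := by
  refine norm_cexp_I_mul_mul_exp_neg_le _ ?_
  have h1 := h.sum_Ico_le_tailSq n N
  have h2 := postVar_nonneg h.grid_pos (a ω) (h.mem_stdSimplex n ω)
  have : 0 ≤ tailSq α n - ∑ l ∈ Finset.Ico n N, α (l + 1) ^ 2 := by linarith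
  positivity

omit h in
lemma measurable_interp {a : Ω → (Fin k → Fin d) → ℝ} {n N : ℕ} (hnN : n ≤ N)
    (ha : ∀ i, Measurable[obsFiltration Y hY n] fun ω => a ω i) (β : ℝ) :
    Measurable[obsFiltration Y hY N] (interp ϑ α g₀ Y a β n N) := by
  have hN := measurable_mixSeq_of_le (ϑ := ϑ) (α := α) (g₀ := g₀) (hY := hY) (le_refl N)
  have hn := measurable_mixSeq_of_le (ϑ := ϑ) (α := α) (g₀ := g₀) (hY := hY) hnN
  have haN := fun i => (ha i).mono ((obsFiltration Y hY).mono hnN) le_rfl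
  refine Measurable.mul (Complex.measurable_exp.comp (measurable_const.mul
    (Complex.measurable_ofReal.comp ((measurable_sum_mul_sub haN hN hn).const_mul β)))) ?_
  exact Complex.measurable_ofReal.comp (Real.measurable_exp.comp
    ((((measurable_postVar haN hn).const_mul _).mul_const _).div_const _).neg)

variable [IsProbabilityMeasure μ]

/-- Both terms share a `𝒢 N`-measurable factor `G` of norm at most one; they differ in that one
Gaussian factor is replaced by the characteristic function of the true increment. The variance is
frozen at `g_n`, so its discrepancy is of the order of `|g_N - g_n|`, whose integral over `A` is at
most `√(tailSq α n) * μ.real A`. The factor `α (N + 1) ^ 2` makes the bounds summable in `N`. -/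
lemma norm_setIntegral_interp_succ_sub_le {n N : ℕ} (hnN : n ≤ N)
    {a : Ω → (Fin k → Fin d) → ℝ} {B β s : ℝ}
    (ha : ∀ i, Measurable[obsFiltration Y hY n] fun ω => a ω i) (haB : ∀ ω i, |a ω i| ≤ B)
    (hβ : 0 ≤ β) (hs : ∀ l, n ≤ l → α (l + 1) ≤ s) (hsmall : 2 * B * (β * s) ≤ 1)
    {A : Set Ω} (hA : MeasurableSet[obsFiltration Y hY n] A) :
    ‖∫ ω in A, interp ϑ α g₀ Y a β n (N + 1) ω ∂μ - ∫ ω in A, interp ϑ α g₀ Y a β n N ω ∂μ‖ ≤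
      (16 * B ^ 3 * (β * s) * β ^ 2 +
        β ^ 2 / 2 * (5 * B ^ 2 * (Fintype.card (Fin k → Fin d) * √(tailSq α n)))) *
        α (N + 1) ^ 2 * μ.real A := by
  rcases isEmpty_or_nonempty Ω with hΩ | ⟨⟨ω₀⟩⟩
  · simp [Measure.eq_zero_of_isEmpty μ]
  rcases isEmpty_or_nonempty (Fin k → Fin d) with he | ⟨⟨i₀⟩⟩
  · have := h.init_mem.2; simp at this
  have hB : 0 ≤ B := (abs_nonneg _).trans (haB ω₀ i₀)
  have hα := h.rate (N + 1) (by omega)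
  have hAN := (obsFiltration Y hY).mono hnN _ hA
  have hA' := (obsFiltration Y hY).le n _ hA
  have hmN := measurable_mixSeq_of_le (ϑ := ϑ) (α := α) (g₀ := g₀) (hY := hY) (le_refl N)
  have hmn := measurable_mixSeq_of_le (ϑ := ϑ) (α := α) (g₀ := g₀) (hY := hY) hnN
  have haN := fun i => (ha i).mono ((obsFiltration Y hY).mono hnN) le_rfl
  set c := β * α (N + 1)
  have hc : 0 ≤ c := mul_nonneg hβ hα.1.le
  have hcs : c ≤ β * s := mul_le_mul_of_nonneg_left (hs N hnN) hβ
  have hcB : 2 * B * c ≤ 1 := (mul_le_mul_of_nonneg_left hcs (by positivity)).trans hsmall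
  set v : Ω → ℝ := fun ω => postVar ϑ (a ω) (mixSeq ϑ α g₀ Y n ω)
  have hv (ω) : 0 ≤ v ω := postVar_nonneg h.grid_pos _ (h.mem_stdSimplex n ω)
  have hvB (ω) : v ω ≤ (2 * B) ^ 2 := postVar_le h.grid_pos (haB ω) (h.mem_stdSimplex n ω)
  -- The Gaussian variance still unspent after step `N + 1`, in units of `β² v`.
  let ρ := tailSq α n - ∑ l ∈ Finset.Ico n (N + 1), α (l + 1) ^ 2
  have hρ : 0 ≤ ρ := by have := h.sum_Ico_le_tailSq n (N + 1); simp only [ρ]; linarith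
  let G : Ω → ℂ := fun ω => Complex.exp (Complex.I *
      (β * ∑ i, a ω i * (mixSeq ϑ α g₀ Y N ω i - mixSeq ϑ α g₀ Y n ω i) : ℝ)) *
    (Real.exp (-(β ^ 2 * v ω * ρ / 2)) : ℂ)
  have hG (ω) : ‖G ω‖ ≤ 1 := norm_cexp_I_mul_mul_exp_neg_le _ (by have := hv ω; positivity)
  have hGm : Measurable[obsFiltration Y hY N] G :=
    Measurable.mul (Complex.measurable_exp.comp (measurable_const.mul
      (Complex.measurable_ofReal.comp ((measurable_sum_mul_sub haN hmN hmn).const_mul β))))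
      (Complex.measurable_ofReal.comp (Real.measurable_exp.comp
        ((((measurable_postVar haN hmn).const_mul _).mul_const _).div_const _).neg))
  let ψ : Ω → (Fin k → ℕ) → ℂ := fun ω z => Complex.exp (Complex.I *
    (c * ∑ i, a ω i * (posterior ϑ (mixSeq ϑ α g₀ Y N ω) z i - mixSeq ϑ α g₀ Y N ω i) : ℝ))
  have hψ (ω z) : ‖ψ ω z‖ ≤ 1 := (norm_cexp_I_mul_ofReal _).le
  have hψm (z) : Measurable[obsFiltration Y hY N] fun ω => ψ ω z :=
    Complex.measurable_exp.comp (measurable_const.mul (Complex.measurable_ofReal.comp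
      ((measurable_sum_mul_sub haN (measurable_posterior hmN measurable_const) hmN).const_mul c)))
  -- The exponent at time `N + 1` splits into its value at time `N` and the new increment, scaled by
  -- `c = β α_{N+1}`.
  have hsucc (ω) : interp ϑ α g₀ Y a β n (N + 1) ω = G ω * ψ ω (Y (N + 1) ω) := by
    simp only [interp, G, ψ]
    rw [mul_right_comm (Complex.exp _), ← Complex.exp_add, ← mul_add, ← Complex.ofReal_add]
    congr 5
    rw [mul_assoc β, ← mul_add]
    congr 1
    rw [Finset.mul_sum, ← Finset.sum_add_distrib]
    refine Finset.sum_congr rfl fun i _ => ?_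
    rw [mixSeq_succ]; ring
  -- At time `N` the same increment is still represented by a Gaussian factor of variance `c² v`.
  have hcur (ω) : interp ϑ α g₀ Y a β n N ω = G ω * (Real.exp (-(c ^ 2 * v ω / 2)) : ℂ) := by
    simp only [interp, G]
    rw [mul_assoc (Complex.exp _), ← Complex.ofReal_mul, ← Real.exp_add]
    congr 4
    simp only [ρ, Finset.sum_Ico_succ_top hnN, v, c]
    ring
  have e := h.setIntegral_next N (E := ℂ) (C := 1) (Φ := fun ω z => G ω * ψ ω z)
    (fun z => (hGm.mul (hψm z)).stronglyMeasurable) (fun ω z => by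
      rw [norm_mul]; exact mul_le_one₀ (hG ω) (norm_nonneg _) (hψ ω z)) hAN
  have hpt (ω) : ∑' z, mixture ϑ (mixSeq ϑ α g₀ Y N ω) z • (G ω * ψ ω z) =
      G ω * ∑' z, mixture ϑ (mixSeq ϑ α g₀ Y N ω) z • ψ ω z := by
    rw [← tsum_mul_left]
    exact tsum_congr fun z => (mul_smul_comm _ _ _).symm
  have hT (ω) : ‖∑' z, mixture ϑ (mixSeq ϑ α g₀ Y N ω) z • ψ ω z‖ ≤ 1 :=
    norm_tsum_mixture_smul_le h.grid_pos (h.mem_stdSimplex N ω) (hψ ω)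
  have hTm : Measurable fun ω => ∑' z, mixture ϑ (mixSeq ϑ α g₀ Y N ω) z • ψ ω z :=
    Measurable.tsum fun z => (measurable_mixture (measurable_mixSeq hY N) measurable_const).smul
      ((hψm z).mono ((obsFiltration Y hY).le N) le_rfl)
  have hGm' := hGm.mono ((obsFiltration Y hY).le N) le_rfl
  have hi1 : Integrable (fun ω => G ω * ∑' z, mixture ϑ (mixSeq ϑ α g₀ Y N ω) z • ψ ω z) μ :=
    Integrable.of_bound (hGm'.mul hTm).aestronglyMeasurable 1 (ae_of_all _ fun ω => by
      rw [norm_mul]; exact mul_le_one₀ (hG ω) (norm_nonneg _) (hT ω))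
  have hi2 : Integrable (interp ϑ α g₀ Y a β n N) μ :=
    Integrable.of_bound ((measurable_interp hnN ha β).mono ((obsFiltration Y hY).le N)
      le_rfl).aestronglyMeasurable 1 (ae_of_all _ fun ω => h.norm_interp_le a β n N ω)
  rw [setIntegral_congr_fun hA' fun ω _ => hsucc ω, e, setIntegral_congr_fun hA' fun ω _ => hpt ω,
    ← integral_sub hi1.integrableOn hi2.integrableOn]
  have hsumi : Integrable (fun ω => ∑ i, |mixSeq ϑ α g₀ Y N ω i - mixSeq ϑ α g₀ Y n ω i|) μ :=
    integrable_finsetSum _ fun i _ => h.integrable_abs_sub N n i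
  calc _ ≤ ∫ ω in A, (2 * (2 * B * c) ^ 3 + c ^ 2 / 2 *
          (5 * B ^ 2 * ∑ i, |mixSeq ϑ α g₀ Y N ω i - mixSeq ϑ α g₀ Y n ω i|)) ∂μ := by
        refine norm_integral_le_of_norm_le ((integrable_const _).add
          ((hsumi.const_mul _).const_mul _).integrableOn) (ae_of_all _ fun ω => ?_)
        rw [hcur, ← mul_sub, norm_mul]
        refine (mul_le_of_le_one_left (norm_nonneg _) (hG ω)).trans ?_
        refine (norm_tsum_mixture_cexp_sub_le h.grid_pos (haB ω) (h.mem_stdSimplex N ω) hc hcB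
          (hv ω) (hvB ω)).trans ?_
        gcongr
        have := abs_postVar_sub_le h.grid_pos (haB ω) (haB ω) (h.mem_stdSimplex N ω)
          (h.mem_stdSimplex n ω)
        simpa using this
    _ = 2 * (2 * B * c) ^ 3 * μ.real A + c ^ 2 / 2 * (5 * B ^ 2 *
          ∑ i, ∫ ω in A, |mixSeq ϑ α g₀ Y N ω i - mixSeq ϑ α g₀ Y n ω i| ∂μ) := by
        rw [integral_add (integrable_const _) ((hsumi.const_mul _).const_mul _).integrableOn,
          setIntegral_const, integral_const_mul, integral_const_mul,
          integral_finsetSum _ fun i _ => (h.integrable_abs_sub N n i).integrableOn, smul_eq_mul,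
          mul_comm (μ.real A)]
    _ ≤ 2 * (2 * B * c) ^ 3 * μ.real A + c ^ 2 / 2 * (5 * B ^ 2 *
          ∑ i : Fin k → Fin d, √(tailSq α n) * μ.real A) := by
        gcongr with i
        exact h.setIntegral_abs_sub_le hnN i hA
    -- Here `2(2Bc)³ = 16B³c · c²`; one factor `c` is kept, to be bounded by `β s`, and `c² = β²
    -- α_{N+1}²`.
    _ = (16 * B ^ 3 * c * β ^ 2 +
        β ^ 2 / 2 * (5 * B ^ 2 * (Fintype.card (Fin k → Fin d) * √(tailSq α n)))) *
        α (N + 1) ^ 2 * μ.real A := by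
        rw [Finset.sum_const, Finset.card_univ, nsmul_eq_mul]
        simp only [c]
        ring
    _ ≤ _ := by gcongr

/-- Telescoping over `N`, then `N → ∞`. At `N = n` the interpolation is the pure Gaussian factor; in
the limit the unspent variance vanishes and `g_N` becomes `g̃`. The accumulated rates are at most
`tailSq α n`. -/
lemma norm_setIntegral_cexp_sub_le (n : ℕ) {a : Ω → (Fin k → Fin d) → ℝ} {B β s : ℝ}
    (ha : ∀ i, Measurable[obsFiltration Y hY n] fun ω => a ω i) (haB : ∀ ω i, |a ω i| ≤ B)
    (hβ : 0 ≤ β) (hs : ∀ l, n ≤ l → α (l + 1) ≤ s) (hsmall : 2 * B * (β * s) ≤ 1)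
    {A : Set Ω} (hA : MeasurableSet[obsFiltration Y hY n] A) :
    ‖∫ ω in A, Complex.exp (Complex.I *
        (β * ∑ i, a ω i * (mixLim ϑ α g₀ Y ω i - mixSeq ϑ α g₀ Y n ω i) : ℝ)) ∂μ -
      ∫ ω in A, (Real.exp (-(β ^ 2 * tailSq α n * postVar ϑ (a ω) (mixSeq ϑ α g₀ Y n ω) / 2)) : ℂ)
        ∂μ‖ ≤
      (16 * B ^ 3 * (β * s) * β ^ 2 +
        β ^ 2 / 2 * (5 * B ^ 2 * (Fintype.card (Fin k → Fin d) * √(tailSq α n)))) *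
        tailSq α n * μ.real A := by
  set η := 16 * B ^ 3 * (β * s) * β ^ 2 +
        β ^ 2 / 2 * (5 * B ^ 2 * (Fintype.card (Fin k → Fin d) * √(tailSq α n))) with hη
  have htel (N : ℕ) (hnN : n ≤ N) :
      ‖∫ ω in A, interp ϑ α g₀ Y a β n N ω ∂μ - ∫ ω in A, interp ϑ α g₀ Y a β n n ω ∂μ‖ ≤
        η * (∑ l ∈ Finset.Ico n N, α (l + 1) ^ 2) * μ.real A := by
    induction N, hnN using Nat.le_induction with
    | base => simp
    | succ N hnN ih =>
      have := h.norm_setIntegral_interp_succ_sub_le hnN ha haB hβ hs hsmall hA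
      rw [← hη] at this
      rw [Finset.sum_Ico_succ_top hnN]
      refine (norm_sub_le_norm_sub_add_norm_sub _ (∫ ω in A, interp ϑ α g₀ Y a β n N ω ∂μ) _).trans
        ((add_le_add this ih).trans_eq ?_)
      ring
  have hn (ω) : interp ϑ α g₀ Y a β n n ω =
      (Real.exp (-(β ^ 2 * tailSq α n * postVar ϑ (a ω) (mixSeq ϑ α g₀ Y n ω) / 2)) : ℂ) := by
    simp only [interp, sub_self, mul_zero, Finset.sum_const_zero, Complex.ofReal_zero,
      Complex.exp_zero, one_mul, Finset.Ico_self, Finset.sum_empty, sub_zero]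
    congr 3
    ring
  simp only [hn] at htel
  have hlim : Tendsto (fun N => ∫ ω in A, interp ϑ α g₀ Y a β n N ω ∂μ) atTop
      (𝓝 (∫ ω in A, Complex.exp (Complex.I *
        (β * ∑ i, a ω i * (mixLim ϑ α g₀ Y ω i - mixSeq ϑ α g₀ Y n ω i) : ℝ)) ∂μ)) := by
    refine tendsto_integral_filter_of_norm_le_const
      (eventually_atTop.2 ⟨n, fun N hN => ((measurable_interp hN ha β).mono
        ((obsFiltration Y hY).le N) le_rfl).aestronglyMeasurable⟩)
      ⟨1, Eventually.of_forall fun N => ae_of_all _ (h.norm_interp_le a β n N)⟩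
      (ae_restrict_of_ae ?_)
    filter_upwards [h.ae_tendsto_mixLim] with ω hω
    have h1 : Tendsto (fun N => tailSq α n - ∑ l ∈ Finset.Ico n N, α (l + 1) ^ 2) atTop (𝓝 0) := by
      simpa using (h.tendsto_sum_Ico n).const_sub (tailSq α n)
    have h2 := ((h1.const_mul
      (β ^ 2 * postVar ϑ (a ω) (mixSeq ϑ α g₀ Y n ω))).div_const 2).neg.rexp.ofReal
    have h3 : Tendsto (fun N => β * ∑ i, a ω i * (mixSeq ϑ α g₀ Y N ω i - mixSeq ϑ α g₀ Y n ω i))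
        atTop (𝓝 (β * ∑ i, a ω i * (mixLim ϑ α g₀ Y ω i - mixSeq ϑ α g₀ Y n ω i))) :=
      (tendsto_finsetSum _ fun i _ => ((hω i).sub_const _).const_mul _).const_mul _
    have h4 := ((h3.ofReal.const_mul Complex.I).cexp).mul h2
    simpa [interp] using h4
  exact le_of_tendsto_of_tendsto (hlim.sub_const _).norm
    (((h.tendsto_sum_Ico n).const_mul η).mul_const _) (eventually_atTop.2 ⟨n, htel⟩)

end NewtonModel
end PoissonQB

namespace PoissonQB

variable {k d : ℕ} {ϑ : Fin d → ℝ}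

/-! ### Linearization of the estimate -/

/-- The coefficients of the linearization at `g` of the `j`-th coordinate of the estimate. -/
noncomputable def thetaCoef (ϑ : Fin d → ℝ) (y : Fin k → ℕ) (g : (Fin k → Fin d) → ℝ) (j : Fin k)
    (i : Fin k → Fin d) : ℝ :=
  (thetaHat ϑ g y j * poissonKernel ϑ y i -
    ((y j : ℝ) + 1) * poissonKernel ϑ (y + Pi.single j 1) i) / mixture ϑ g y

/-- The coefficients of the linearization at `g` of the estimate in the direction `t`. -/
noncomputable def dirCoef (ϑ : Fin d → ℝ) (y : Fin k → ℕ) (t : EuclideanSpace ℝ (Fin k))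
    (g : (Fin k → Fin d) → ℝ) (i : Fin k → Fin d) : ℝ :=
  ∑ j, t j * thetaCoef ϑ y g j i

lemma poissonKernel_le_one (hϑ : ∀ i, 0 < ϑ i) (y : Fin k → ℕ) (i : Fin k → Fin d) :
    poissonKernel ϑ y i ≤ 1 :=
  le_hasSum (hasSum_poissonKernel hϑ i) y fun z _ => (poissonKernel_pos hϑ z i).le

lemma continuous_mixture (y : Fin k → ℕ) :
    Continuous fun g : (Fin k → Fin d) → ℝ => mixture ϑ g y :=
  continuous_finsetSum _ fun i _ => continuous_const.mul (continuous_apply i)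

lemma continuousOn_thetaHat (hϑ : ∀ i, 0 < ϑ i) (y : Fin k → ℕ) (j : Fin k) :
    ContinuousOn (fun g : (Fin k → Fin d) → ℝ => thetaHat ϑ g y j) (stdSimplex ℝ _) :=
  (continuous_const.mul (continuous_mixture _)).continuousOn.div (continuous_mixture y).continuousOn
    fun _ hg => (mixture_pos hϑ hg y).ne'

lemma continuousOn_thetaCoef (hϑ : ∀ i, 0 < ϑ i) (y : Fin k → ℕ) (j : Fin k)
    (i : Fin k → Fin d) :
    ContinuousOn (fun g : (Fin k → Fin d) → ℝ => thetaCoef ϑ y g j i) (stdSimplex ℝ _) :=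
  (((continuousOn_thetaHat hϑ y j).mul continuousOn_const).sub continuousOn_const).div
    (continuous_mixture y).continuousOn fun _ hg => (mixture_pos hϑ hg y).ne'

lemma continuousOn_dirCoef (hϑ : ∀ i, 0 < ϑ i) (y : Fin k → ℕ) (t : EuclideanSpace ℝ (Fin k))
    (i : Fin k → Fin d) :
    ContinuousOn (fun g : (Fin k → Fin d) → ℝ => dirCoef ϑ y t g i) (stdSimplex ℝ _) :=
  continuousOn_finsetSum _ fun j _ => continuousOn_const.mul (continuousOn_thetaCoef hϑ y j i)

/-- The coefficients are continuous on the compact simplex, thanks to the positivity of the mixture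
there. -/
lemma exists_abs_thetaCoef_le (hϑ : ∀ i, 0 < ϑ i) (y : Fin k → ℕ) :
    ∃ B ≥ 0, ∀ g : (Fin k → Fin d) → ℝ, g ∈ stdSimplex ℝ _ → ∀ j i, |thetaCoef ϑ y g j i| ≤ B := by
  have h (j : Fin k) (i : Fin k → Fin d) :=
    (isCompact_stdSimplex ℝ (Fin k → Fin d)).exists_bound_of_continuousOn
      (continuousOn_thetaCoef hϑ y j i)
  choose C hC using h
  refine ⟨∑ j, ∑ i, |C j i|, by positivity, fun g hg j i => (hC j i g hg).trans ?_⟩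
  calc C j i ≤ |C j i| := le_abs_self _
    _ ≤ ∑ i, |C j i| := Finset.single_le_sum (f := fun i => |C j i|)
        (fun _ _ => abs_nonneg _) (Finset.mem_univ i)
    _ ≤ _ := Finset.single_le_sum (f := fun j => ∑ i, |C j i|)
        (fun _ _ => by positivity) (Finset.mem_univ j)

lemma abs_dirCoef_le {y : Fin k → ℕ} {B : ℝ} {g : (Fin k → Fin d) → ℝ}
    (hB : ∀ j i, |thetaCoef ϑ y g j i| ≤ B) (t : EuclideanSpace ℝ (Fin k)) (i : Fin k → Fin d) :
    |dirCoef ϑ y t g i| ≤ (∑ j, |t j|) * B := by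
  rw [Finset.sum_mul]
  refine (Finset.abs_sum_le_sum_abs _ _).trans (Finset.sum_le_sum fun j _ => ?_)
  rw [abs_mul]
  exact mul_le_mul_of_nonneg_left (hB j i) (abs_nonneg _)

lemma measurable_thetaHat {Ω : Type*} {m : MeasurableSpace Ω} {g : Ω → (Fin k → Fin d) → ℝ}
    (hg : ∀ i, Measurable fun ω => g ω i) (y : Fin k → ℕ) (j : Fin k) :
    Measurable fun ω => thetaHat ϑ (g ω) y j :=
  ((measurable_mixture hg measurable_const).const_mul _).div (measurable_mixture hg measurable_const)

lemma measurable_thetaCoef {Ω : Type*} {m : MeasurableSpace Ω} {g : Ω → (Fin k → Fin d) → ℝ}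
    (hg : ∀ i, Measurable fun ω => g ω i) (y : Fin k → ℕ) (j : Fin k) (i : Fin k → Fin d) :
    Measurable fun ω => thetaCoef ϑ y (g ω) j i :=
  (((measurable_thetaHat hg y j).mul_const _).sub_const _).div
    (measurable_mixture hg measurable_const)

lemma measurable_dirCoef {Ω : Type*} {m : MeasurableSpace Ω} {g : Ω → (Fin k → Fin d) → ℝ}
    (hg : ∀ i, Measurable fun ω => g ω i) (y : Fin k → ℕ) (t : EuclideanSpace ℝ (Fin k))
    (i : Fin k → Fin d) : Measurable fun ω => dirCoef ϑ y t (g ω) i :=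
  Finset.measurable_sum _ fun j _ => (measurable_thetaCoef hg y j i).const_mul _

lemma sum_thetaCoef_mul (g g' : (Fin k → Fin d) → ℝ) (y : Fin k → ℕ) (j : Fin k) :
    ∑ i, thetaCoef ϑ y g j i * g' i = (thetaHat ϑ g y j * mixture ϑ g' y -
      ((y j : ℝ) + 1) * mixture ϑ g' (y + Pi.single j 1)) / mixture ϑ g y := by
  simp only [thetaCoef, mixture, Finset.mul_sum, ← Finset.sum_sub_distrib, Finset.sum_div]
  exact Finset.sum_congr rfl fun i _ => by ring

/-- Euler's identity: the estimate is homogeneous of degree zero in `g`. The linear functional may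
thus be centered at `g` at no cost. -/
lemma sum_thetaCoef_mul_self (hϑ : ∀ i, 0 < ϑ i) {g : (Fin k → Fin d) → ℝ}
    (hg : g ∈ stdSimplex ℝ _) (y : Fin k → ℕ) (j : Fin k) :
    ∑ i, thetaCoef ϑ y g j i * g i = 0 := by
  have := (mixture_pos hϑ hg y).ne'
  rw [sum_thetaCoef_mul]
  simp only [thetaHat]
  field_simp
  ring

/-- For a ratio of linear functions the linearization is exact up to the factor `p_g / p_{g'}`. The
coefficients are minus the gradient at `g`, which matches pairing them with `g' - g`. -/
lemma thetaHat_sub (hϑ : ∀ i, 0 < ϑ i) {g g' : (Fin k → Fin d) → ℝ}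
    (hg : g ∈ stdSimplex ℝ _) (hg' : g' ∈ stdSimplex ℝ _) (y : Fin k → ℕ) (j : Fin k) :
    thetaHat ϑ g y j - thetaHat ϑ g' y j =
      (∑ i, thetaCoef ϑ y g j i * (g' i - g i)) * (mixture ϑ g y / mixture ϑ g' y) := by
  have h1 := (mixture_pos hϑ hg y).ne'
  have h2 := (mixture_pos hϑ hg' y).ne'
  simp only [mul_sub, Finset.sum_sub_distrib, sum_thetaCoef_mul_self hϑ hg, sub_zero,
    sum_thetaCoef_mul]
  simp only [thetaHat]
  field_simp

lemma inner_thetaHat_sub (hϑ : ∀ i, 0 < ϑ i) {g g' : (Fin k → Fin d) → ℝ}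
    (hg : g ∈ stdSimplex ℝ _) (hg' : g' ∈ stdSimplex ℝ _) (y : Fin k → ℕ)
    (t : EuclideanSpace ℝ (Fin k)) :
    inner ℝ (thetaHat ϑ g y - thetaHat ϑ g' y) t =
      (∑ i, dirCoef ϑ y t g i * (g' i - g i)) * (mixture ϑ g y / mixture ϑ g' y) := by
  simp only [PiLp.inner_apply, PiLp.sub_apply, thetaHat_sub hϑ hg hg', dirCoef, Finset.sum_mul]
  rw [Finset.sum_comm]
  refine Finset.sum_congr rfl fun j _ => ?_
  simp only [RCLike.inner_apply, conj_trivial, Finset.mul_sum]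
  exact Finset.sum_congr rfl fun i _ => by ring

lemma abs_sum_mul_sub_le {ι : Type*} [Fintype ι] {a g g' : ι → ℝ} {B : ℝ}
    (ha : ∀ i, |a i| ≤ B) : |∑ i, a i * (g' i - g i)| ≤ B * ∑ i, |g' i - g i| := by
  rw [Finset.mul_sum]
  refine (Finset.abs_sum_le_sum_abs _ _).trans (Finset.sum_le_sum fun i _ => ?_)
  rw [abs_mul]
  exact mul_le_mul_of_nonneg_right (ha i) (abs_nonneg _)

lemma abs_mixture_sub_le (hϑ : ∀ i, 0 < ϑ i) (g g' : (Fin k → Fin d) → ℝ) (y : Fin k → ℕ) :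
    |mixture ϑ g' y - mixture ϑ g y| ≤ ∑ i, |g' i - g i| := by
  have := abs_sum_mul_sub_le (a := fun i => poissonKernel ϑ y i) (g := g) (g' := g') (B := 1)
    fun i => by rw [abs_of_pos (poissonKernel_pos hϑ y i)]; exact poissonKernel_le_one hϑ y i
  simpa [mixture, mul_sub, Finset.sum_sub_distrib] using this

/-- The linearization error is quadratic, uniformly over all mixing distributions. -/
lemma exists_inner_thetaHat_sub_linear_le (hϑ : ∀ i, 0 < ϑ i) (y : Fin k → ℕ)
    (t : EuclideanSpace ℝ (Fin k)) :
    ∃ C ≥ 0, ∀ g g' : (Fin k → Fin d) → ℝ, g ∈ stdSimplex ℝ _ → g' ∈ stdSimplex ℝ _ →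
      |inner ℝ (thetaHat ϑ g y - thetaHat ϑ g' y) t - ∑ i, dirCoef ϑ y t g i * (g' i - g i)| ≤
        C * ∑ i, (g' i - g i) ^ 2 := by
  obtain ⟨B, hB0, hB⟩ := exists_abs_thetaCoef_le hϑ y
  obtain ⟨c, hc0, hc⟩ := exists_le_mixture hϑ y
  refine ⟨(∑ j, |t j|) * B / c * Fintype.card (Fin k → Fin d), by positivity,
    fun g g' hg hg' => ?_⟩
  have hp := mixture_pos hϑ hg' y
  have h1 := abs_sum_mul_sub_le (g := g) (g' := g') (abs_dirCoef_le (hB g hg) t)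
  have h2 := abs_mixture_sub_le hϑ g g' y
  set L := ∑ i, dirCoef ϑ y t g i * (g' i - g i)
  set M := (∑ j, |t j|) * B
  have hM : 0 ≤ M := by positivity
  have hsq : (∑ i, |g' i - g i|) ^ 2 ≤ Fintype.card (Fin k → Fin d) * ∑ i, (g' i - g i) ^ 2 := by
    simpa [sq_abs] using sq_sum_le_card_mul_sum_sq (s := Finset.univ) (f := fun i => |g' i - g i|)
  set W := ∑ i, |g' i - g i|
  have hW : 0 ≤ W := Finset.sum_nonneg fun _ _ => abs_nonneg _
  -- The error is `L * (p_g / p_{g'} - 1)`, a product of two factors each of first order in `g' -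
  -- g`.
  rw [inner_thetaHat_sub hϑ hg hg',
    show L * (mixture ϑ g y / mixture ϑ g' y) - L =
      -(L * (mixture ϑ g' y - mixture ϑ g y)) / mixture ϑ g' y by field_simp; ring,
    abs_div, abs_neg, abs_mul, abs_of_pos hp]
  calc |L| * |mixture ϑ g' y - mixture ϑ g y| / mixture ϑ g' y
      ≤ (M * W) * W / c := div_le_div₀ (by positivity)
        (mul_le_mul h1 h2 (abs_nonneg _) (by positivity)) hc0 (hc g' hg')
    _ = M / c * W ^ 2 := by ring
    _ ≤ M / c * (Fintype.card (Fin k → Fin d) * ∑ i, (g' i - g i) ^ 2) := by gcongr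
    _ = _ := by ring

/-- The estimate is Lipschitz in the mixing distribution. -/
lemma exists_inner_thetaHat_sub_le (hϑ : ∀ i, 0 < ϑ i) (y : Fin k → ℕ) :
    ∃ C ≥ 0, ∀ (t : EuclideanSpace ℝ (Fin k)) (g g' : (Fin k → Fin d) → ℝ),
      g ∈ stdSimplex ℝ _ → g' ∈ stdSimplex ℝ _ →
      |inner ℝ (thetaHat ϑ g y - thetaHat ϑ g' y) t| ≤ C * ‖t‖ * ∑ i, |g' i - g i| := by
  obtain ⟨B, hB0, hB⟩ := exists_abs_thetaCoef_le hϑ y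
  obtain ⟨c, hc0, hc⟩ := exists_le_mixture hϑ y
  refine ⟨k * B / c, by positivity, fun t g g' hg hg' => ?_⟩
  have hp := mixture_pos hϑ hg y
  have hp' := mixture_pos hϑ hg' y
  have h1 := abs_sum_mul_sub_le (g := g) (g' := g') (abs_dirCoef_le (hB g hg) t)
  have hle : mixture ϑ g y ≤ 1 :=
    le_hasSum (hasSum_mixture hϑ hg) y fun z _ => mixture_nonneg hϑ hg z
  have ht : ∑ j, |t j| ≤ k * ‖t‖ := by
    refine (Finset.sum_le_sum fun j _ => PiLp.norm_apply_le t j).trans ?_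
    simp
  rw [inner_thetaHat_sub hϑ hg hg', abs_mul, abs_of_pos (div_pos hp hp')]
  have hW : 0 ≤ ∑ i, |g' i - g i| := Finset.sum_nonneg fun _ _ => abs_nonneg _
  calc _ ≤ ((∑ j, |t j|) * B * ∑ i, |g' i - g i|) * (1 / c) :=
        mul_le_mul h1 (div_le_div₀ zero_le_one hle hc0 (hc g' hg')) (by positivity) (by positivity)
    _ ≤ ((k * ‖t‖) * B * ∑ i, |g' i - g i|) * (1 / c) := by gcongr
    _ = _ := by ring

/-! ### The covariance matrix -/

lemma thetaHat_pos (hϑ : ∀ i, 0 < ϑ i) {g : (Fin k → Fin d) → ℝ} (hg : g ∈ stdSimplex ℝ _)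
    (y : Fin k → ℕ) (j : Fin k) : 0 < thetaHat ϑ g y j :=
  div_pos (mul_pos (by positivity) (mixture_pos hϑ hg _)) (mixture_pos hϑ hg _)

/-- Where `gᵢ > 0`, multiplying the difference of the two posteriors by the estimate gives
`-thetaCoef * gᵢ`. So `W` is the predictive covariance of the linear functionals `thetaCoef`, the
two signs cancelling. -/
lemma thetaHat_mul_score (hϑ : ∀ i, 0 < ϑ i) {g : (Fin k → Fin d) → ℝ} (hg : g ∈ stdSimplex ℝ _)
    (y : Fin k → ℕ) (j : Fin k) (z : Fin k → ℕ) :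
    thetaHat ϑ g y j * score ϑ g y j z =
      -∑ i, thetaCoef ϑ y g j i * (posterior ϑ g z i - g i) := by
  have h1 := (mixture_pos hϑ hg y).ne'
  have h2 := (mixture_pos hϑ hg (y + Pi.single j 1)).ne'
  simp only [mul_sub, Finset.sum_sub_distrib, sum_thetaCoef_mul_self hϑ hg, sub_zero]
  rw [score, Finset.mul_sum, ← Finset.sum_neg_distrib]
  refine Finset.sum_congr rfl fun i _ => ?_
  rcases (hg.1 i).eq_or_lt with h0 | h0
  -- When `gᵢ = 0` the posterior weight vanishes, so both summands are zero whatever the division by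
  -- `gᵢ` means.
  · simp [posterior, ← h0]
  · generalize hq : posterior ϑ g z i = q
    simp only [posterior, thetaCoef, thetaHat]
    field_simp
    ring

lemma summable_mixture_mul_mul (hϑ : ∀ i, 0 < ϑ i) {g : (Fin k → Fin d) → ℝ}
    (hg : g ∈ stdSimplex ℝ _) {a a' : (Fin k → Fin d) → ℝ} {B : ℝ} (ha : ∀ i, |a i| ≤ B)
    (ha' : ∀ i, |a' i| ≤ B) :
    Summable fun z => mixture ϑ g z * ((∑ i, a i * (posterior ϑ g z i - g i)) *
      ∑ i, a' i * (posterior ϑ g z i - g i)) := by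
  refine summable_mixture_smul (E := ℝ) hϑ hg (C := 2 * B * (2 * B)) fun z => ?_
  have h1 := abs_sum_mul_sub_le_of_mem_stdSimplex ha (posterior_mem_stdSimplex hϑ hg z) hg
  have h2 := abs_sum_mul_sub_le_of_mem_stdSimplex ha' (posterior_mem_stdSimplex hϑ hg z) hg
  rw [norm_mul]
  exact mul_le_mul h1 h2 (norm_nonneg _) ((abs_nonneg _).trans h1)

lemma hasSum_covW (hϑ : ∀ i, 0 < ϑ i) {g : (Fin k → Fin d) → ℝ} (hg : g ∈ stdSimplex ℝ _)
    (y : Fin k → ℕ) (j j' : Fin k) :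
    HasSum (fun z => mixture ϑ g z *
      ((∑ i, thetaCoef ϑ y g j i * (posterior ϑ g z i - g i)) *
        ∑ i, thetaCoef ϑ y g j' i * (posterior ϑ g z i - g i))) (covW ϑ g y j j') := by
  obtain ⟨B, -, hB⟩ := exists_abs_thetaCoef_le hϑ y
  have hs := summable_mixture_mul_mul hϑ hg (hB g hg j) (hB g hg j')
  convert hs.hasSum using 1
  rw [covW, ← tsum_mul_left]
  refine tsum_congr fun z => ?_
  have e := thetaHat_mul_score hϑ hg y j z
  have e' := thetaHat_mul_score hϑ hg y j' z
  rw [← neg_mul_neg (∑ i, thetaCoef ϑ y g j i * (posterior ϑ g z i - g i)), ← e, ← e']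
  ring

lemma summable_mixture_mul_score (hϑ : ∀ i, 0 < ϑ i) {g : (Fin k → Fin d) → ℝ}
    (hg : g ∈ stdSimplex ℝ _) (y : Fin k → ℕ) (j j' : Fin k) :
    Summable fun z => mixture ϑ g z * (score ϑ g y j z * score ϑ g y j' z) := by
  have h1 := thetaHat_pos hϑ hg y j
  have h2 := thetaHat_pos hϑ hg y j'
  refine ((hasSum_covW hϑ hg y j j').summable.mul_left
    (1 / (thetaHat ϑ g y j * thetaHat ϑ g y j'))).congr fun z => ?_
  have e := thetaHat_mul_score hϑ hg y j z
  have e' := thetaHat_mul_score hϑ hg y j' z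
  rw [← neg_mul_neg (∑ i, thetaCoef ϑ y g j i * (posterior ϑ g z i - g i)), ← e, ← e']
  field_simp

/-- Bilinearity of the predictive covariance. This identifies the limiting characteristic function
with that of the Gaussian distribution, and makes `W` positive semidefinite. -/
lemma dotProduct_covW_mulVec (hϑ : ∀ i, 0 < ϑ i) {g : (Fin k → Fin d) → ℝ}
    (hg : g ∈ stdSimplex ℝ _) (y : Fin k → ℕ) (t : EuclideanSpace ℝ (Fin k)) :
    t.ofLp ⬝ᵥ (covW ϑ g y).mulVec t.ofLp = postVar ϑ (dirCoef ϑ y t g) g := by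
  have hs := hasSum_sum fun j (_ : j ∈ Finset.univ) => hasSum_sum fun j' (_ : j' ∈ Finset.univ) =>
    (hasSum_covW hϑ hg y j j').mul_left (t j * t j')
  have e : t.ofLp ⬝ᵥ (covW ϑ g y).mulVec t.ofLp = ∑ j, ∑ j', t j * t j' * covW ϑ g y j j' := by
    simp only [dotProduct, Matrix.mulVec, Finset.mul_sum]
    exact Finset.sum_congr rfl fun j _ => Finset.sum_congr rfl fun j' _ => by ring
  rw [e]
  refine hs.unique ((hasSum_postVar hϑ (dirCoef ϑ y t g) hg).congr_fun fun z => ?_)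
  have e1 : ∑ i, dirCoef ϑ y t g i * (posterior ϑ g z i - g i) =
      ∑ j, t j * ∑ i, thetaCoef ϑ y g j i * (posterior ϑ g z i - g i) := by
    simp only [dirCoef, Finset.sum_mul, Finset.mul_sum]
    rw [Finset.sum_comm]
    exact Finset.sum_congr rfl fun j _ => Finset.sum_congr rfl fun i _ => by ring
  rw [e1, sq, Finset.sum_mul_sum, Finset.mul_sum]
  refine Finset.sum_congr rfl fun j _ => ?_
  rw [Finset.mul_sum]
  exact Finset.sum_congr rfl fun j' _ => by ring

lemma posSemidef_covW (hϑ : ∀ i, 0 < ϑ i) {g : (Fin k → Fin d) → ℝ}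
    (hg : g ∈ stdSimplex ℝ _) (y : Fin k → ℕ) : (covW ϑ g y).PosSemidef := by
  refine .of_dotProduct_mulVec_nonneg ?_ fun x => ?_
  · ext j j'
    simp only [Matrix.conjTranspose_apply, star_trivial, covW]
    rw [mul_comm (thetaHat ϑ g y j')]
    simp only [mul_comm]
  · have := dotProduct_covW_mulVec hϑ hg y (WithLp.toLp 2 x)
    rw [star_trivial, this]
    exact postVar_nonneg hϑ _ hg

lemma measurable_covW {Ω : Type*} {m : MeasurableSpace Ω} {g : Ω → (Fin k → Fin d) → ℝ}
    (hg : ∀ i, Measurable fun ω => g ω i) (y : Fin k → ℕ) (j j' : Fin k) :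
    Measurable fun ω => covW ϑ (g ω) y j j' := by
  have hs (j z) : Measurable fun ω => score ϑ (g ω) y j z :=
    Finset.measurable_sum _ fun i _ => ((measurable_posterior hg measurable_const i).div (hg i)).mul
      ((measurable_posterior hg measurable_const i).sub (measurable_posterior hg measurable_const i))
  exact ((measurable_thetaHat hg y j).mul (measurable_thetaHat hg y j')).mul
    (Measurable.tsum fun z => (measurable_mixture hg measurable_const).mul ((hs j z).mul (hs j' z)))

end PoissonQB

namespace PoissonQB

/-! ### Measurability of Gaussian kernels -/

/-- Open sets form a generating π-system, and by the portmanteau theorem their mass is lower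
semicontinuous in the measure. -/
lemma measurable_toMeasure_of_continuous {T E : Type*} [TopologicalSpace T] [MeasurableSpace T]
    [OpensMeasurableSpace T] [PseudoMetricSpace E] [MeasurableSpace E] [BorelSpace E]
    {f : T → ProbabilityMeasure E} (hf : Continuous f) :
    Measurable fun s => (f s : Measure E) := by
  refine Measurable.measure_of_isPiSystem_of_isProbabilityMeasure
    (BorelSpace.measurable_eq (α := E)) isPiSystem_isOpen fun U hU => ?_
  refine LowerSemicontinuous.measurable fun s c hc => ?_
  exact eventually_lt_of_lt_liminf
    (hc.trans_le (ProbabilityMeasure.le_liminf_measure_open_of_tendsto (hf.tendsto s) hU))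

/-- The centered Gaussian distribution, as a function of its covariance matrix. -/
noncomputable def centeredGaussian (k : ℕ)
    (M : {M : Fin k → Fin k → ℝ // (Matrix.of M).PosSemidef}) :
    ProbabilityMeasure (EuclideanSpace ℝ (Fin k)) :=
  ⟨multivariateGaussian 0 (Matrix.of M.1), inferInstance⟩

/-- By Lévy's theorem it is enough that the characteristic function depends continuously on the
covariance; its formula requires positive semidefiniteness, hence the subtype. -/
lemma continuous_centeredGaussian (k : ℕ) : Continuous (centeredGaussian k) := by
  refine continuous_iff_seqContinuous.2 fun M M₀ hM => ?_
  refine ProbabilityMeasure.tendsto_of_tendsto_charFun fun t => ?_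
  have hc (M : {M : Fin k → Fin k → ℝ // (Matrix.of M).PosSemidef}) :
      charFun (centeredGaussian k M : Measure (EuclideanSpace ℝ (Fin k))) t =
        Complex.exp (-((t.ofLp ⬝ᵥ (Matrix.of M.1).mulVec t.ofLp : ℝ) : ℂ) / 2) := by
    change charFun (multivariateGaussian 0 (Matrix.of M.1)) t = _
    rw [charFun_multivariateGaussian M.2]
    simp [neg_div]
  have hd : Continuous fun M : {M : Fin k → Fin k → ℝ // (Matrix.of M).PosSemidef} =>
      t.ofLp ⬝ᵥ (Matrix.of M.1).mulVec t.ofLp := by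
    have hij (i j) : Continuous fun M : {M : Fin k → Fin k → ℝ // (Matrix.of M).PosSemidef} =>
        M.1 i j := (continuous_apply_apply i j).comp continuous_subtype_val
    simp only [dotProduct, Matrix.mulVec, Matrix.of_apply]
    exact continuous_finsetSum _ fun i _ => continuous_const.mul
      (continuous_finsetSum _ fun j _ => (hij i j).mul continuous_const)
  have hlim := (((Complex.continuous_ofReal.comp hd).neg.div_const 2).cexp.tendsto M₀).comp hM
  simp only [Function.comp_def, hc]
  exact hlim

lemma measurable_multivariateGaussian {Ω : Type*} {mΩ : MeasurableSpace Ω} {k : ℕ}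
    {S : Ω → Matrix (Fin k) (Fin k) ℝ} (hS : ∀ j j', Measurable fun ω => S ω j j')
    (hpsd : ∀ ω, (S ω).PosSemidef) :
    Measurable fun ω => multivariateGaussian 0 (S ω) := by
  have hg : Measurable fun ω => (⟨fun j j' => S ω j j', hpsd ω⟩ :
      {M : Fin k → Fin k → ℝ // (Matrix.of M).PosSemidef}) :=
    (measurable_pi_lambda _ fun j => measurable_pi_lambda _ fun j' => hS j j').subtype_mk
  have hc := measurable_toMeasure_of_continuous (continuous_centeredGaussian k)
  have e (ω : Ω) : multivariateGaussian 0 (S ω) =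
      (centeredGaussian k ⟨fun j j' => S ω j j', hpsd ω⟩ : Measure _) := rfl
  simp only [e]
  exact hc.comp hg

/-! ### Bounds on conditional characteristic functions -/

section CondCharFun

variable {Ω : Type*} {m mΩ : MeasurableSpace Ω} {μ : Measure Ω} [IsProbabilityMeasure μ]

/-- For an `m`-measurable `u`, sets of `m` suffice to test `u ≤ c` and `-u ≤ c`; both are checked
for the measure trimmed to `m`. -/
lemma ae_abs_le_of_forall_abs_setIntegral_le (hm : m ≤ mΩ) {u : Ω → ℝ} {c : ℝ}
    (hu : StronglyMeasurable[m] u) (hui : Integrable u μ)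
    (h : ∀ A, MeasurableSet[m] A → |∫ ω in A, u ω ∂μ| ≤ c * μ.real A) :
    ∀ᵐ ω ∂μ, |u ω| ≤ c := by
  have key (v : Ω → ℝ) (hv : StronglyMeasurable[m] v) (hvi : Integrable v μ)
      (hle : ∀ A, MeasurableSet[m] A → ∫ ω in A, v ω ∂μ ≤ c * μ.real A) : ∀ᵐ ω ∂μ, v ω ≤ c := by
    refine ae_of_ae_trim hm ?_
    refine ae_le_of_forall_setIntegral_le (hvi.trim hm hv) (integrable_const c) fun A hA _ => ?_
    rw [← setIntegral_trim hm hv hA, ← setIntegral_trim hm stronglyMeasurable_const hA,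
      setIntegral_const, smul_eq_mul, mul_comm]
    exact hle A hA
  filter_upwards [key u hu hui fun A hA => (le_abs_self _).trans (h A hA),
    key (-u) hu.neg hui.neg fun A hA => by
      simp only [Pi.neg_apply, integral_neg]
      exact (neg_le_abs _).trans (h A hA)] with ω h1 h2
  exact abs_le.2 ⟨by simp only [Pi.neg_apply] at h2; linarith, h1⟩

/-- Real and imaginary parts are treated separately, which costs the factor `2`. -/
lemma ae_norm_le_of_forall_norm_setIntegral_le (hm : m ≤ mΩ) {u : Ω → ℂ} {c : ℝ}
    (hu : StronglyMeasurable[m] u) (hui : Integrable u μ)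
    (h : ∀ A, MeasurableSet[m] A → ‖∫ ω in A, u ω ∂μ‖ ≤ c * μ.real A) :
    ∀ᵐ ω ∂μ, ‖u ω‖ ≤ 2 * c := by
  have h1 := ae_abs_le_of_forall_abs_setIntegral_le hm
    (Complex.continuous_re.comp_stronglyMeasurable hu) hui.re fun A hA => by
      have e : ∫ ω in A, (u ω).re ∂μ = (∫ ω in A, u ω ∂μ).re := integral_re hui.integrableOn
      exact (congrArg _ e).le.trans ((Complex.abs_re_le_norm _).trans (h A hA))
  have h2 := ae_abs_le_of_forall_abs_setIntegral_le hm
    (Complex.continuous_im.comp_stronglyMeasurable hu) hui.im fun A hA => by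
      have e : ∫ ω in A, (u ω).im ∂μ = (∫ ω in A, u ω ∂μ).im := integral_im hui.integrableOn
      exact (congrArg _ e).le.trans ((Complex.abs_im_le_norm _).trans (h A hA))
  filter_upwards [h1, h2] with ω h1 h2
  exact (Complex.norm_le_abs_re_add_abs_im _).trans (by linarith)

variable {E : Type*} [NormedAddCommGroup E] [InnerProductSpace ℝ E]
  [MeasurableSpace E] [BorelSpace E]

lemma norm_charFun_condLaw_le [PolishSpace E] (X : Ω → E) (t : E) (ω : Ω) :
    ‖charFun (condLaw μ m X ω) t‖ ≤ 1 :=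
  have := (condLaw_isMarkovKernel μ m X).isProbabilityMeasure ω
  norm_charFun_le_one t

lemma stronglyMeasurable_charFun_condLaw [PolishSpace E] (X : Ω → E) (t : E) :
    StronglyMeasurable[m] fun ω => charFun (condLaw μ m X ω) t := by
  have : IsMarkovKernel (condLaw μ m X) := inferInstance
  have hc : StronglyMeasurable fun x : E => Complex.exp ((inner ℝ x t : ℝ) * Complex.I) :=
    (by fun_prop : Continuous _).stronglyMeasurable
  exact StronglyMeasurable.integral_kernel (κ := condLaw μ m X) hc

lemma integrable_cexp_inner {X : Ω → E} (hX : AEMeasurable X μ) (t : E) :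
    Integrable (fun ω => Complex.exp ((inner ℝ (X ω) t : ℝ) * Complex.I)) μ := by
  have hc : Measurable fun x : E => Complex.exp ((inner ℝ x t : ℝ) * Complex.I) :=
    (by fun_prop : Continuous _).measurable
  exact Integrable.of_bound (hc.comp_aemeasurable hX).aestronglyMeasurable 1
    (ae_of_all _ fun ω => (Complex.norm_exp_ofReal_mul_I _).le)

lemma integrable_charFun_condLaw [PolishSpace E] (hm : m ≤ mΩ) (X : Ω → E) (t : E) :
    Integrable (fun ω => charFun (condLaw μ m X ω) t) μ :=
  Integrable.of_bound ((stronglyMeasurable_charFun_condLaw X t).mono hm).aestronglyMeasurable 1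
    (ae_of_all _ fun ω => norm_charFun_condLaw_le X t ω)

/-- The characteristic function of the conditional law is a version of the conditional expectation
of `exp (i⟨X, t⟩)`. -/
lemma setIntegral_charFun_condLaw [PolishSpace E] (hm : m ≤ mΩ) {X : Ω → E}
    (hX : AEMeasurable X μ) (t : E) {A : Set Ω} (hA : MeasurableSet[m] A) :
    ∫ ω in A, charFun (condLaw μ m X ω) t ∂μ =
      ∫ ω in A, Complex.exp ((inner ℝ (X ω) t : ℝ) * Complex.I) ∂μ := by
  have hi := integrable_cexp_inner hX t
  have hc : StronglyMeasurable fun x : E => Complex.exp ((inner ℝ x t : ℝ) * Complex.I) :=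
    (by fun_prop : Continuous _).stronglyMeasurable
  have e := condExp_ae_eq_integral_condDistrib (mβ := m) (X := (id : Ω → Ω))
    (Measurable.of_le_map (by rwa [MeasurableSpace.map_id])) hX hc hi
  rw [MeasurableSpace.comap_id] at e
  rw [← setIntegral_condExp hm hi hA]
  refine setIntegral_congr_ae (hm A hA) (e.mono fun ω hω _ => ?_)
  exact hω.symm

end CondCharFun

lemma norm_cexp_mul_I_sub_le (x y : ℝ) :
    ‖Complex.exp (x * Complex.I) - Complex.exp (y * Complex.I)‖ ≤ |x - y| := by
  have e : Complex.exp (x * Complex.I) - Complex.exp (y * Complex.I) =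
      Complex.exp (y * Complex.I) * (Complex.exp (Complex.I * ((x - y : ℝ) : ℂ)) - 1) := by
    rw [mul_sub, ← Complex.exp_add, mul_one]
    congr 2
    push_cast; ring
  rw [e, norm_mul, Complex.norm_exp_ofReal_mul_I, one_mul]
  exact Real.norm_exp_I_mul_ofReal_sub_one_le

/-- Equi-Lipschitz functions that converge on a dense set converge everywhere. -/
lemma tendsto_of_tendsto_dense_of_lipschitz {E : Type*} [SeminormedAddCommGroup E] {T : Set E}
    (hT : Dense T) {φ : ℕ → E → ℂ} {ψ : E → ℂ} {K : ℝ} {n₀ : ℕ}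
    (hφ : ∀ n, Continuous (φ n)) (hψ : Continuous ψ)
    (hlip : ∀ n ≥ n₀, ∀ t ∈ T, ∀ t' ∈ T, ‖φ n t - φ n t'‖ ≤ K * ‖t - t'‖)
    (hlim : ∀ t ∈ T, Tendsto (fun n => φ n t) atTop (𝓝 (ψ t))) (t : E) :
    Tendsto (fun n => φ n t) atTop (𝓝 (ψ t)) := by
  -- The bound is closed in its first argument, so density frees that argument from `T`; this is
  -- enough to approximate `t` by a point of `T`.
  have hlip' (n : ℕ) (hn : n ≥ n₀) (t' : E) (ht' : t' ∈ T) : ‖φ n t - φ n t'‖ ≤ K * ‖t - t'‖ := by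
    have hcl : IsClosed {s | ‖φ n s - φ n t'‖ ≤ K * ‖s - t'‖} :=
      isClosed_le ((hφ n).sub continuous_const).norm
        (continuous_const.mul (continuous_id.sub continuous_const).norm)
    exact hcl.closure_subset_iff.2 (fun s hs => hlip n hn s hs t' ht') (hT t)
  rw [Metric.tendsto_atTop]
  intro ε hε
  have h1 : ∀ᶠ s in 𝓝 t, K * ‖t - s‖ < ε / 3 := by
    have : Tendsto (fun s => K * ‖t - s‖) (𝓝 t) (𝓝 (K * ‖t - t‖)) :=
      (continuous_const.mul (continuous_const.sub continuous_id).norm).tendsto t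
    rw [sub_self, norm_zero, mul_zero] at this
    exact this.eventually_lt_const (by linarith)
  have h2 : ∀ᶠ s in 𝓝 t, dist (ψ s) (ψ t) < ε / 3 :=
    Metric.tendsto_nhds.1 (hψ.tendsto t) _ (by linarith)
  obtain ⟨s, hsT, hs1, hs2⟩ := hT.inter_nhds_nonempty (h1.and h2)
  obtain ⟨N, hN⟩ := Metric.tendsto_atTop.1 (hlim s hsT) (ε / 3) (by linarith)
  refine ⟨max N n₀, fun n hn => ?_⟩
  have h3 := hN n ((le_max_left _ _).trans hn)
  have h4 := hlip' n ((le_max_right _ _).trans hn) s hsT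
  rw [← dist_eq_norm] at h4
  calc dist (φ n t) (ψ t) ≤ dist (φ n t) (φ n s) + dist (φ n s) (ψ s) + dist (ψ s) (ψ t) :=
        dist_triangle4 _ _ _ _
    _ < ε := by linarith

end PoissonQB

/-! ### Conditional characteristic functions of the rescaled error -/

namespace PoissonQB

variable {k d : ℕ} {ϑ : Fin d → ℝ} {Ω : Type*} {mΩ : MeasurableSpace Ω} {μ : Measure Ω}
  {α : ℕ → ℝ} {g₀ : (Fin k → Fin d) → ℝ} {Y : ℕ → Ω → Fin k → ℕ} {hY : ∀ n, Measurable (Y n)}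

/-- The estimation error, rescaled by `β`. -/
noncomputable def scaledError (ϑ : Fin d → ℝ) (α : ℕ → ℝ) (g₀ : (Fin k → Fin d) → ℝ)
    (Y : ℕ → Ω → Fin k → ℕ) (y : Fin k → ℕ) (β : ℝ) (n : ℕ) (ω : Ω) : EuclideanSpace ℝ (Fin k) :=
  β • (thetaHat ϑ (mixSeq ϑ α g₀ Y n ω) y - thetaHat ϑ (mixLim ϑ α g₀ Y ω) y)

lemma measurable_thetaHat_vec {m : MeasurableSpace Ω} {g : Ω → (Fin k → Fin d) → ℝ}
    (hg : ∀ i, Measurable fun ω => g ω i) (y : Fin k → ℕ) :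
    Measurable fun ω => thetaHat ϑ (g ω) y :=
  (WithLp.measurable_toLp 2 _).comp (measurable_pi_lambda _ fun j => measurable_thetaHat hg y j)

lemma measurable_scaledError (hY : ∀ n, Measurable (Y n)) (y : Fin k → ℕ) (β : ℝ) (n : ℕ) :
    Measurable (scaledError ϑ α g₀ Y y β n) :=
  ((measurable_thetaHat_vec (measurable_mixSeq hY n) y).sub
    (measurable_thetaHat_vec (measurable_mixLim hY) y)).const_smul β

lemma inner_scaledError (y : Fin k → ℕ) (β : ℝ) (n : ℕ) (ω : Ω) (t : EuclideanSpace ℝ (Fin k)) :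
    inner ℝ (scaledError ϑ α g₀ Y y β n ω) t =
      β * inner ℝ (thetaHat ϑ (mixSeq ϑ α g₀ Y n ω) y - thetaHat ϑ (mixLim ϑ α g₀ Y ω) y) t := by
  rw [scaledError, real_inner_smul_left]

namespace NewtonModel

variable (h : NewtonModel μ ϑ α g₀ Y hY) [IsProbabilityMeasure μ]
include h

/-- First the error is replaced by its linearization, at a cost controlled by the second moment of
`g̃ - g_n` because `x ↦ exp (ix)` is 1-Lipschitz; then the telescoping bound applies to the linear
part. -/
lemma norm_setIntegral_cexp_inner_sub_le (y : Fin k → ℕ) (t : EuclideanSpace ℝ (Fin k)) (n : ℕ)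
    {B C β s : ℝ} (hC0 : 0 ≤ C)
    (hC : ∀ g g' : (Fin k → Fin d) → ℝ, g ∈ stdSimplex ℝ _ → g' ∈ stdSimplex ℝ _ →
      |inner ℝ (thetaHat ϑ g y - thetaHat ϑ g' y) t - ∑ i, dirCoef ϑ y t g i * (g' i - g i)| ≤
        C * ∑ i, (g' i - g i) ^ 2)
    (hB : ∀ g : (Fin k → Fin d) → ℝ, g ∈ stdSimplex ℝ _ → ∀ i, |dirCoef ϑ y t g i| ≤ B)
    (hβ : 0 ≤ β) (hs : ∀ l, n ≤ l → α (l + 1) ≤ s) (hsmall : 2 * B * (β * s) ≤ 1)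
    {A : Set Ω} (hA : MeasurableSet[obsFiltration Y hY n] A) :
    ‖∫ ω in A, Complex.exp ((inner ℝ (scaledError ϑ α g₀ Y y β n ω) t : ℝ) * Complex.I) ∂μ -
      ∫ ω in A, (Real.exp (-(β ^ 2 * tailSq α n *
        postVar ϑ (dirCoef ϑ y t (mixSeq ϑ α g₀ Y n ω)) (mixSeq ϑ α g₀ Y n ω) / 2)) : ℂ) ∂μ‖ ≤
      (β * C * (Fintype.card (Fin k → Fin d) * tailSq α n) +
        (16 * B ^ 3 * (β * s) * β ^ 2 +
          β ^ 2 / 2 * (5 * B ^ 2 * (Fintype.card (Fin k → Fin d) * √(tailSq α n)))) *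
          tailSq α n) * μ.real A := by
  set a : Ω → (Fin k → Fin d) → ℝ := fun ω => dirCoef ϑ y t (mixSeq ϑ α g₀ Y n ω)
  have ha (i) : Measurable[obsFiltration Y hY n] fun ω => a ω i :=
    measurable_dirCoef (measurable_newton n) y t i
  have hcore := h.norm_setIntegral_cexp_sub_le n ha
    (fun ω i => hB _ (h.mem_stdSimplex n ω) i) hβ hs hsmall hA
  set L : Ω → ℝ := fun ω => β * ∑ i, a ω i * (mixLim ϑ α g₀ Y ω i - mixSeq ϑ α g₀ Y n ω i)
  have hLm : Measurable L := (measurable_sum_mul_sub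
    (fun i => (ha i).mono ((obsFiltration Y hY).le n) le_rfl) (measurable_mixLim hY)
    (measurable_mixSeq hY n)).const_mul β
  have hiL : Integrable (fun ω => Complex.exp (Complex.I * L ω)) μ :=
    Integrable.of_bound (Complex.measurable_exp.comp (measurable_const.mul
      (Complex.measurable_ofReal.comp hLm))).aestronglyMeasurable 1
      (ae_of_all _ fun ω => (norm_cexp_I_mul_ofReal _).le)
  have hiX := integrable_cexp_inner
    (measurable_scaledError (ϑ := ϑ) (α := α) (g₀ := g₀) hY y β n).aemeasurable (μ := μ) t
  have hlin : ‖∫ ω in A, Complex.exp ((inner ℝ (scaledError ϑ α g₀ Y y β n ω) t : ℝ) * Complex.I) ∂μ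
      - ∫ ω in A, Complex.exp (Complex.I * L ω) ∂μ‖ ≤
      β * C * (Fintype.card (Fin k → Fin d) * tailSq α n) * μ.real A := by
    rw [← integral_sub hiX.integrableOn hiL.integrableOn]
    have hsumi : Integrable
        (fun ω => ∑ i, (mixLim ϑ α g₀ Y ω i - mixSeq ϑ α g₀ Y n ω i) ^ 2) μ :=
      integrable_finsetSum _ fun i _ => h.integrable_sq_mixLim_sub n i
    calc _ ≤ ∫ ω in A, β * C * ∑ i, (mixLim ϑ α g₀ Y ω i - mixSeq ϑ α g₀ Y n ω i) ^ 2 ∂μ := by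
          refine norm_integral_le_of_norm_le (hsumi.const_mul _).integrableOn
            (ae_restrict_of_ae (h.ae_mixLim_mem.mono fun ω hω => ?_))
          rw [mul_comm Complex.I]
          refine (norm_cexp_mul_I_sub_le _ _).trans ?_
          rw [inner_scaledError, ← mul_sub, abs_mul, abs_of_nonneg hβ, mul_assoc]
          exact mul_le_mul_of_nonneg_left (hC _ _ (h.mem_stdSimplex n ω) hω) hβ
      _ = β * C * ∑ i, ∫ ω in A, (mixLim ϑ α g₀ Y ω i - mixSeq ϑ α g₀ Y n ω i) ^ 2 ∂μ := by
          rw [integral_const_mul,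
            integral_finsetSum _ fun i _ => (h.integrable_sq_mixLim_sub n i).integrableOn]
      _ ≤ β * C * ∑ i : Fin k → Fin d, tailSq α n * μ.real A := by
          gcongr with i
          exact h.setIntegral_sq_mixLim_sub_le n i hA
      _ = _ := by
          rw [Finset.sum_const, Finset.card_univ, nsmul_eq_mul]
          ring
  refine (norm_sub_le_norm_sub_add_norm_sub _ (∫ ω in A, Complex.exp (Complex.I * L ω) ∂μ) _).trans
    ((add_le_add hlin hcore).trans_eq ?_)
  ring

/-- The conditional characteristic function of the rescaled error is close to that of a Gaussian
distribution, with a deterministic error. -/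
lemma ae_norm_charFun_condLaw_sub_le (y : Fin k → ℕ) (t : EuclideanSpace ℝ (Fin k)) (n : ℕ)
    {B C β s : ℝ} (hC0 : 0 ≤ C)
    (hC : ∀ g g' : (Fin k → Fin d) → ℝ, g ∈ stdSimplex ℝ _ → g' ∈ stdSimplex ℝ _ →
      |inner ℝ (thetaHat ϑ g y - thetaHat ϑ g' y) t - ∑ i, dirCoef ϑ y t g i * (g' i - g i)| ≤
        C * ∑ i, (g' i - g i) ^ 2)
    (hB : ∀ g : (Fin k → Fin d) → ℝ, g ∈ stdSimplex ℝ _ → ∀ i, |dirCoef ϑ y t g i| ≤ B)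
    (hβ : 0 ≤ β) (hs : ∀ l, n ≤ l → α (l + 1) ≤ s) (hsmall : 2 * B * (β * s) ≤ 1) :
    ∀ᵐ ω ∂μ, ‖charFun (condLaw μ (obsFiltration Y hY n) (scaledError ϑ α g₀ Y y β n) ω) t -
      (Real.exp (-(β ^ 2 * tailSq α n *
        postVar ϑ (dirCoef ϑ y t (mixSeq ϑ α g₀ Y n ω)) (mixSeq ϑ α g₀ Y n ω) / 2)) : ℂ)‖ ≤
      2 * (β * C * (Fintype.card (Fin k → Fin d) * tailSq α n) +
        (16 * B ^ 3 * (β * s) * β ^ 2 +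
          β ^ 2 / 2 * (5 * B ^ 2 * (Fintype.card (Fin k → Fin d) * √(tailSq α n)))) *
          tailSq α n) := by
  have hle := (obsFiltration Y hY).le n
  have hX := (measurable_scaledError (ϑ := ϑ) (α := α) (g₀ := g₀) hY y β n).aemeasurable (μ := μ)
  have hEm : Measurable[obsFiltration Y hY n] fun ω => (Real.exp (-(β ^ 2 * tailSq α n *
      postVar ϑ (dirCoef ϑ y t (mixSeq ϑ α g₀ Y n ω)) (mixSeq ϑ α g₀ Y n ω) / 2)) : ℂ) :=
    Complex.measurable_ofReal.comp (Real.measurable_exp.comp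
      (((measurable_postVar (measurable_dirCoef (measurable_newton n) y t)
        (measurable_newton n)).const_mul _).div_const _).neg)
  have hE : Integrable (fun ω => (Real.exp (-(β ^ 2 * tailSq α n *
      postVar ϑ (dirCoef ϑ y t (mixSeq ϑ α g₀ Y n ω)) (mixSeq ϑ α g₀ Y n ω) / 2)) : ℂ)) μ :=
    Integrable.of_bound (hEm.mono hle le_rfl).aestronglyMeasurable 1 (ae_of_all _ fun ω => by
      rw [Complex.norm_real, Real.norm_of_nonneg (Real.exp_pos _).le, Real.exp_le_one_iff,
        neg_nonpos]
      have := postVar_nonneg h.grid_pos (dirCoef ϑ y t (mixSeq ϑ α g₀ Y n ω)) (h.mem_stdSimplex n ω)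
      have := (h.tailSq_pos n).le
      positivity)
  have hφ := integrable_charFun_condLaw (μ := μ) hle (scaledError ϑ α g₀ Y y β n) t
  refine ae_norm_le_of_forall_norm_setIntegral_le hle
    ((stronglyMeasurable_charFun_condLaw _ t).sub hEm.stronglyMeasurable) (hφ.sub hE)
    fun A hA => ?_
  rw [integral_sub hφ.integrableOn hE.integrableOn, setIntegral_charFun_condLaw hle hX t hA]
  exact h.norm_setIntegral_cexp_inner_sub_le y t n hC0 hC hB hβ hs hsmall hA

/-- The conditional first moment of the error is of order `β √(tailSq α n)`. The null set depends on
`t` and `t'`, so the bound is used for countably many pairs. -/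
lemma ae_norm_charFun_condLaw_sub_charFun_le (y : Fin k → ℕ) (t t' : EuclideanSpace ℝ (Fin k))
    (n : ℕ) {C β : ℝ} (hC0 : 0 ≤ C)
    (hC : ∀ (t : EuclideanSpace ℝ (Fin k)) (g g' : (Fin k → Fin d) → ℝ),
      g ∈ stdSimplex ℝ _ → g' ∈ stdSimplex ℝ _ →
      |inner ℝ (thetaHat ϑ g y - thetaHat ϑ g' y) t| ≤ C * ‖t‖ * ∑ i, |g' i - g i|)
    (hβ : 0 ≤ β) :
    ∀ᵐ ω ∂μ, ‖charFun (condLaw μ (obsFiltration Y hY n) (scaledError ϑ α g₀ Y y β n) ω) t -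
      charFun (condLaw μ (obsFiltration Y hY n) (scaledError ϑ α g₀ Y y β n) ω) t'‖ ≤
      2 * (C * Fintype.card (Fin k → Fin d) * (β * √(tailSq α n)) * ‖t - t'‖) := by
  have hle := (obsFiltration Y hY).le n
  have hX := (measurable_scaledError (ϑ := ϑ) (α := α) (g₀ := g₀) hY y β n).aemeasurable (μ := μ)
  have hφ (t) := integrable_charFun_condLaw (μ := μ) hle (scaledError ϑ α g₀ Y y β n) t
  refine ae_norm_le_of_forall_norm_setIntegral_le hle
    ((stronglyMeasurable_charFun_condLaw _ t).sub (stronglyMeasurable_charFun_condLaw _ t'))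
    ((hφ t).sub (hφ t')) fun A hA => ?_
  rw [integral_sub (hφ t).integrableOn (hφ t').integrableOn, setIntegral_charFun_condLaw hle hX t hA,
    setIntegral_charFun_condLaw hle hX t' hA, ← integral_sub
      (integrable_cexp_inner hX t).integrableOn (integrable_cexp_inner hX t').integrableOn]
  have hsumi : Integrable (fun ω => ∑ i, |mixLim ϑ α g₀ Y ω i - mixSeq ϑ α g₀ Y n ω i|) μ :=
    integrable_finsetSum _ fun i _ => (h.integrable_mixLim_sub n i).abs
  calc _ ≤ ∫ ω in A, β * (C * ‖t - t'‖) *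
          ∑ i, |mixLim ϑ α g₀ Y ω i - mixSeq ϑ α g₀ Y n ω i| ∂μ := by
        refine norm_integral_le_of_norm_le (hsumi.const_mul _).integrableOn
          (ae_restrict_of_ae (h.ae_mixLim_mem.mono fun ω hω => ?_))
        refine (norm_cexp_mul_I_sub_le _ _).trans ?_
        rw [← inner_sub_right, inner_scaledError, abs_mul, abs_of_nonneg hβ, mul_assoc β]
        exact mul_le_mul_of_nonneg_left (hC _ _ _ (h.mem_stdSimplex n ω) hω) hβ
    _ = β * (C * ‖t - t'‖) *
          ∑ i, ∫ ω in A, |mixLim ϑ α g₀ Y ω i - mixSeq ϑ α g₀ Y n ω i| ∂μ := by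
        rw [integral_const_mul,
          integral_finsetSum _ fun i _ => (h.integrable_mixLim_sub n i).abs.integrableOn]
    _ ≤ β * (C * ‖t - t'‖) * ∑ i : Fin k → Fin d, √(tailSq α n) * μ.real A := by
        gcongr with i
        exact h.setIntegral_abs_mixLim_sub_le n i hA
    _ = _ := by
        rw [Finset.sum_const, Finset.card_univ, nsmul_eq_mul]
        ring

end NewtonModel
end PoissonQB

namespace PoissonQB

variable {k d : ℕ} {ϑ : Fin d → ℝ} {Ω : Type*} {mΩ : MeasurableSpace Ω} {μ : Measure Ω}
  {α : ℕ → ℝ} {g₀ : (Fin k → Fin d) → ℝ} {Y : ℕ → Ω → Fin k → ℕ} {hY : ∀ n, Measurable (Y n)}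

/-! ### Asymptotics of the rates -/

section Rates

variable {b : ℕ → ℝ}

lemma summable_sq_add (hα : Summable fun n : ℕ => α (n + 1) ^ 2) (n : ℕ) :
    Summable fun m : ℕ => α (n + m) ^ 2 := by
  have h0 : Summable fun n : ℕ => α n ^ 2 := (summable_nat_add_iff 1).1 hα
  simpa [add_comm] using (summable_nat_add_iff n).2 h0

lemma sq_le_iSup_sq (hα : Summable fun n : ℕ => α (n + 1) ^ 2) (n m : ℕ) :
    α (n + m) ^ 2 ≤ ⨆ m : ℕ, α (n + m) ^ 2 :=
  le_ciSup (f := fun m : ℕ => α (n + m) ^ 2)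
    (summable_sq_add hα n).tendsto_atTop_zero.bddAbove_range m

lemma le_sqrt_iSup_sq (hα : Summable fun n : ℕ => α (n + 1) ^ 2) (n l : ℕ) (hl : n ≤ l) :
    α (l + 1) ≤ √(⨆ m : ℕ, α (n + m) ^ 2) := by
  refine Real.le_sqrt_of_sq_le ?_
  have := sq_le_iSup_sq hα n (l + 1 - n)
  rwa [show n + (l + 1 - n) = l + 1 by omega] at this

/-- `tailSq α n` starts at `n + 1`, one index after the sum in the hypothesis; the missing `b n * α
n ^ 2` is dominated by the supremum term. -/
lemma tendsto_mul_tailSq (hα : Summable fun n : ℕ => α (n + 1) ^ 2)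
    (hb_pos : ∀ n, 1 ≤ n → 0 < b n)
    (hsup : Tendsto (fun n => b n * ⨆ m : ℕ, α (n + m) ^ 2) atTop (𝓝 0))
    (hsum : Tendsto (fun n => b n * ∑' m : ℕ, α (n + m) ^ 2) atTop (𝓝 1)) :
    Tendsto (fun n => b n * tailSq α n) atTop (𝓝 1) := by
  have h0 : Tendsto (fun n => b n * α n ^ 2) atTop (𝓝 0) := by
    refine squeeze_zero' ?_ ?_ hsup
    · filter_upwards [eventually_ge_atTop 1] with n hn
      have := hb_pos n hn
      positivity
    · filter_upwards [eventually_ge_atTop 1] with n hn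
      exact mul_le_mul_of_nonneg_left (sq_le_iSup_sq hα n 0) (hb_pos n hn).le
  have h1 := hsum.sub h0
  rw [sub_zero] at h1
  refine h1.congr fun n => ?_
  rw [(summable_sq_add hα n).tsum_eq_zero_add, tailSq, add_zero]
  simp only [add_assoc]
  ring

lemma tendsto_sqrt_mul_sqrt_iSup (hb_pos : ∀ n, 1 ≤ n → 0 < b n)
    (hsup : Tendsto (fun n => b n * ⨆ m : ℕ, α (n + m) ^ 2) atTop (𝓝 0)) :
    Tendsto (fun n => √(b n) * √(⨆ m : ℕ, α (n + m) ^ 2)) atTop (𝓝 0) := by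
  have h := hsup.sqrt
  rw [Real.sqrt_zero] at h
  refine h.congr' ?_
  filter_upwards [eventually_ge_atTop 1] with n hn
  exact Real.sqrt_mul (hb_pos n hn).le _

lemma tendsto_zero_of_tendsto_mul {R : ℕ → ℝ} {c : ℕ → ℝ} (hc : Tendsto c atTop atTop)
    {x : ℝ} (h : Tendsto (fun n => c n * R n) atTop (𝓝 x)) : Tendsto R atTop (𝓝 0) := by
  have h1 := h.mul hc.inv_tendsto_atTop
  rw [mul_zero] at h1
  refine h1.congr' ?_
  filter_upwards [hc.eventually_gt_atTop 0] with n hn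
  rw [Pi.inv_apply, mul_comm, inv_mul_cancel_left₀ hn.ne']

/-- Here `b R → 1`, while `√b s`, `√R` and `√b R = (b R) / √b` tend to zero, and every term contains
one of these vanishing factors. -/
lemma tendsto_error_bound (hb_pos : ∀ n, 1 ≤ n → 0 < b n) (hb_top : Tendsto b atTop atTop)
    {s R : ℕ → ℝ} (hs : Tendsto (fun n => √(b n) * s n) atTop (𝓝 0))
    (hR : Tendsto (fun n => b n * R n) atTop (𝓝 1)) (B C D : ℝ) :
    Tendsto (fun n => 2 * (√(b n) * C * (D * R n) +
      (16 * B ^ 3 * (√(b n) * s n) * √(b n) ^ 2 +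
        √(b n) ^ 2 / 2 * (5 * B ^ 2 * (D * √(R n)))) * R n)) atTop (𝓝 0) := by
  have hR0 := (tendsto_zero_of_tendsto_mul hb_top hR).sqrt
  rw [Real.sqrt_zero] at hR0
  have hbR : Tendsto (fun n => √(b n) * R n) atTop (𝓝 0) := by
    refine tendsto_zero_of_tendsto_mul (Real.tendsto_sqrt_atTop.comp hb_top) (x := 1)
      (hR.congr' ?_)
    filter_upwards [eventually_ge_atTop 1] with n hn
    rw [Function.comp_apply, ← mul_assoc, Real.mul_self_sqrt (hb_pos n hn).le]
  have h := (((hbR.const_mul (C * D)).add ((hs.mul hR).const_mul (16 * B ^ 3))).add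
    ((hR0.mul hR).const_mul (5 / 2 * B ^ 2 * D))).const_mul 2
  simp only [mul_zero, zero_mul, add_zero] at h
  refine h.congr' ?_
  filter_upwards [eventually_ge_atTop 1] with n hn
  rw [Real.sq_sqrt (hb_pos n hn).le]
  ring

end Rates

lemma tendsto_postVar_dirCoef (hϑ : ∀ i, 0 < ϑ i) (y : Fin k → ℕ) (t : EuclideanSpace ℝ (Fin k))
    {g : ℕ → (Fin k → Fin d) → ℝ} {g' : (Fin k → Fin d) → ℝ} (hg : ∀ n, g n ∈ stdSimplex ℝ _)
    (hg' : g' ∈ stdSimplex ℝ _) (hlim : ∀ i, Tendsto (fun n => g n i) atTop (𝓝 (g' i))) :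
    Tendsto (fun n => postVar ϑ (dirCoef ϑ y t (g n)) (g n)) atTop
      (𝓝 (postVar ϑ (dirCoef ϑ y t g') g')) := by
  obtain ⟨B, -, hB⟩ := exists_abs_thetaCoef_le hϑ y
  have hlim' : Tendsto g atTop (𝓝[stdSimplex ℝ _] g') :=
    tendsto_nhdsWithin_iff.2 ⟨tendsto_pi_nhds.2 hlim, Eventually.of_forall hg⟩
  have ha (i) : Tendsto (fun n => dirCoef ϑ y t (g n) i) atTop (𝓝 (dirCoef ϑ y t g' i)) :=
    (continuousOn_dirCoef hϑ y t i g' hg').tendsto.comp hlim'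
  have hz {f : ℕ → (Fin k → Fin d) → ℝ} {f' : (Fin k → Fin d) → ℝ}
      (hf : ∀ i, Tendsto (fun n => f n i) atTop (𝓝 (f' i))) :
      Tendsto (fun n => ∑ i, |f n i - f' i|) atTop (𝓝 0) := by
    have : Tendsto (fun n => ∑ i, |f n i - f' i|) atTop (𝓝 (∑ i, |f' i - f' i|)) :=
      tendsto_finsetSum _ fun i _ => ((hf i).sub_const _).abs
    simpa using this
  rw [tendsto_iff_norm_sub_tendsto_zero]
  refine squeeze_zero (fun n => norm_nonneg _) (fun n => abs_postVar_sub_le hϑ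
    (abs_dirCoef_le (hB _ (hg n)) t) (abs_dirCoef_le (hB _ hg') t) (hg n) hg') ?_
  simpa using ((hz hlim).const_mul _).add ((hz ha).const_mul _)

namespace NewtonModel

variable (h : NewtonModel μ ϑ α g₀ Y hY) [IsProbabilityMeasure μ]
include h

/-- The error bounds are deterministic and there are countably many `n`, so they hold simultaneously
off one null set; there the approximating Gaussian factor converges, since `b_n R_n → 1` and `g_n →
g̃`. -/
lemma ae_tendsto_charFun_condLaw {b : ℕ → ℝ} (hb_pos : ∀ n, 1 ≤ n → 0 < b n)
    (hb_top : Tendsto b atTop atTop)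
    (hsup : Tendsto (fun n => b n * ⨆ m : ℕ, α (n + m) ^ 2) atTop (𝓝 0))
    (hsum : Tendsto (fun n => b n * ∑' m : ℕ, α (n + m) ^ 2) atTop (𝓝 1))
    (y : Fin k → ℕ) (t : EuclideanSpace ℝ (Fin k)) :
    ∀ᵐ ω ∂μ, Tendsto (fun n => charFun (condLaw μ (obsFiltration Y hY n)
        (scaledError ϑ α g₀ Y y √(b n) n) ω) t) atTop
      (𝓝 (Real.exp (-(postVar ϑ (dirCoef ϑ y t (mixLim ϑ α g₀ Y ω)) (mixLim ϑ α g₀ Y ω) / 2)))) := by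
  obtain ⟨B₀, hB₀0, hB₀⟩ := exists_abs_thetaCoef_le h.grid_pos y
  obtain ⟨C, hC0, hC⟩ := exists_inner_thetaHat_sub_linear_le h.grid_pos y t
  have hB (g : (Fin k → Fin d) → ℝ) (hg : g ∈ stdSimplex ℝ _) := abs_dirCoef_le (hB₀ g hg) t
  set B := (∑ j, |t j|) * B₀
  have hs := tendsto_sqrt_mul_sqrt_iSup hb_pos hsup
  have hR := tendsto_mul_tailSq h.summable_sq hb_pos hsup hsum
  have hsmall : ∀ᶠ n in atTop, 2 * B * (√(b n) * √(⨆ m : ℕ, α (n + m) ^ 2)) ≤ 1 := by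
    have h1 := hs.const_mul (2 * B)
    rw [mul_zero] at h1
    exact h1.eventually_le_const one_pos
  obtain ⟨n₀, hn₀⟩ := eventually_atTop.1 (hsmall.and (eventually_ge_atTop 1))
  have hall := ae_all_iff.2 fun n : ℕ => (ae_all_iff.2 fun hn : n₀ ≤ n =>
    h.ae_norm_charFun_condLaw_sub_le y t n hC0 hC hB (Real.sqrt_nonneg (b n))
      (le_sqrt_iSup_sq h.summable_sq n) (hn₀ n hn).1)
  filter_upwards [hall, h.ae_tendsto_mixLim, h.ae_mixLim_mem] with ω h1 h2 h3
  have hε := tendsto_error_bound hb_pos hb_top hs hR B C (Fintype.card (Fin k → Fin d))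
  have hV := tendsto_postVar_dirCoef h.grid_pos y t (fun n => h.mem_stdSimplex n ω) h3 h2
  have hE : Tendsto (fun n => (Real.exp (-(√(b n) ^ 2 * tailSq α n *
      postVar ϑ (dirCoef ϑ y t (mixSeq ϑ α g₀ Y n ω)) (mixSeq ϑ α g₀ Y n ω) / 2)) : ℂ)) atTop
      (𝓝 (Real.exp (-(postVar ϑ (dirCoef ϑ y t (mixLim ϑ α g₀ Y ω))
        (mixLim ϑ α g₀ Y ω) / 2)))) := by
    have hlim := ((hR.mul hV).div_const 2).neg.rexp.ofReal
    rw [one_mul] at hlim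
    refine hlim.congr' ?_
    filter_upwards [eventually_ge_atTop 1] with n hn
    rw [Real.sq_sqrt (hb_pos n hn).le]
  have hd := squeeze_zero_norm' (eventually_atTop.2 ⟨n₀, h1⟩) hε
  simpa using hd.add hE

lemma ae_forall_tendsto_charFun_condLaw {b : ℕ → ℝ} (hb_pos : ∀ n, 1 ≤ n → 0 < b n)
    (hb_top : Tendsto b atTop atTop)
    (hsup : Tendsto (fun n => b n * ⨆ m : ℕ, α (n + m) ^ 2) atTop (𝓝 0))
    (hsum : Tendsto (fun n => b n * ∑' m : ℕ, α (n + m) ^ 2) atTop (𝓝 1)) (y : Fin k → ℕ) :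
    ∀ᵐ ω ∂μ, ∀ t, Tendsto (fun n => charFun (condLaw μ (obsFiltration Y hY n)
        (scaledError ϑ α g₀ Y y √(b n) n) ω) t) atTop
      (𝓝 (charFun (multivariateGaussian 0 (covW ϑ (mixLim ϑ α g₀ Y ω) y)) t)) := by
  obtain ⟨T, hTc, hTd⟩ := TopologicalSpace.exists_countable_dense (EuclideanSpace ℝ (Fin k))
  obtain ⟨C, hC0, hC⟩ := exists_inner_thetaHat_sub_le h.grid_pos y
  have hR := tendsto_mul_tailSq h.summable_sq hb_pos hsup hsum
  obtain ⟨n₀, hn₀⟩ := eventually_atTop.1 ((hR.eventually_le_const one_lt_two).and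
    (eventually_ge_atTop 1))
  have hlim := (ae_ball_iff hTc).2 fun t _ =>
    h.ae_tendsto_charFun_condLaw hb_pos hb_top hsup hsum y t
  have hlip := ae_all_iff.2 fun n : ℕ => (ae_ball_iff hTc).2 fun t _ => (ae_ball_iff hTc).2
    fun t' _ => h.ae_norm_charFun_condLaw_sub_charFun_le y t t' n hC0 hC (Real.sqrt_nonneg (b n))
  filter_upwards [hlim, hlip, h.ae_mixLim_mem] with ω h1 h2 h3
  have hprob (n) : IsProbabilityMeasure (condLaw μ (obsFiltration Y hY n)
      (scaledError ϑ α g₀ Y y √(b n) n) ω) :=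
    (condLaw_isMarkovKernel μ _ _).isProbabilityMeasure ω
  refine tendsto_of_tendsto_dense_of_lipschitz hTd (n₀ := n₀)
    (K := 2 * (C * Fintype.card (Fin k → Fin d) * √2)) (fun n => continuous_charFun)
    continuous_charFun (fun n hn t ht t' ht' => (h2 n t ht t' ht').trans ?_) fun t ht => ?_
  -- Since `b_n R_n → 1`, it is eventually at most `2`, which gives a Lipschitz constant independent
  -- of `n`.
  · have hβ : √(b n) * √(tailSq α n) ≤ √2 := by
      rw [← Real.sqrt_mul (hb_pos n (hn₀ n hn).2).le]
      exact Real.sqrt_le_sqrt (hn₀ n hn).1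
    rw [mul_assoc 2]
    gcongr
  · rw [charFun_multivariateGaussian (posSemidef_covW h.grid_pos h3 y),
      dotProduct_covW_mulVec h.grid_pos h3]
    convert h1 t ht using 2
    push_cast
    simp

end NewtonModel
end PoissonQB

/-! ### The main theorem -/

theorem mainTheorem6 {Ω : Type*} {mΩ : MeasurableSpace Ω} (μ : Measure Ω) [IsProbabilityMeasure μ]
    {k d : ℕ} (ϑ : Fin d → ℝ) (hϑ_mono : StrictMono ϑ) (hϑ_pos : ∀ i, 0 < ϑ i)
    (g₀ : (Fin k → Fin d) → ℝ) (hg₀_pos : ∀ i, 0 < g₀ i) (hg₀_sum : ∑ i, g₀ i = 1)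
    (α : ℕ → ℝ) (hα : ∀ n, 1 ≤ n → 0 < α n ∧ α n < 1)
    (Y : ℕ → Ω → Fin k → ℕ) (hY : ∀ n, Measurable (Y n))
    (hmodel : PoissonQB.IsLearningModel μ ϑ α g₀ Y hY)
    (b : ℕ → ℝ) (hb_pos : ∀ n, 1 ≤ n → 0 < b n)
    (hb_mono : MonotoneOn b (Set.Ici 1)) (hb_top : Tendsto b atTop atTop)
    (hαb_four : Summable fun n : ℕ => α (n + 1) ^ 4 * b (n + 1) ^ 2)
    (hα_sq : Summable fun n : ℕ => α (n + 1) ^ 2)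
    (hαb_sup : Tendsto (fun n => b n * ⨆ m : ℕ, α (n + m) ^ 2) atTop (𝓝 0))
    (hαb_sum : Tendsto (fun n => b n * ∑' m : ℕ, α (n + m) ^ 2) atTop (𝓝 1)) :
    (∀ᵐ ω ∂μ,
      (∀ i, Tendsto (fun n => PoissonQB.newton ϑ α g₀ (fun m => Y m ω) n i) atTop
        (𝓝 (PoissonQB.newtonLimit ϑ α g₀ (fun m => Y m ω) i))) ∧
      (∀ i, 0 ≤ PoissonQB.newtonLimit ϑ α g₀ (fun m => Y m ω) i) ∧
      ∑ i, PoissonQB.newtonLimit ϑ α g₀ (fun m => Y m ω) i = 1) ∧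
    ∀ y : Fin k → ℕ,
      (∀ᵐ ω ∂μ, ∀ j j', Summable fun z : Fin k → ℕ =>
        PoissonQB.mixture ϑ (PoissonQB.newtonLimit ϑ α g₀ fun m => Y m ω) z *
          (PoissonQB.score ϑ (PoissonQB.newtonLimit ϑ α g₀ fun m => Y m ω) y j z *
            PoissonQB.score ϑ (PoissonQB.newtonLimit ϑ α g₀ fun m => Y m ω) y j' z)) ∧
      ∃ (K : Kernel Ω (EuclideanSpace ℝ (Fin k))) (_ : IsMarkovKernel K)
        (S : Ω → Matrix (Fin k) (Fin k) ℝ),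
        PoissonQB.IsCenteredGaussianKernel K S ∧
        (∀ᵐ ω ∂μ,
          S ω = PoissonQB.covW ϑ (PoissonQB.newtonLimit ϑ α g₀ fun m => Y m ω) y) ∧
        PoissonQB.AlmostSureCondConv μ (PoissonQB.obsFiltration Y hY)
          (fun n ω => Real.sqrt (b n) •
            (PoissonQB.thetaHat ϑ (PoissonQB.newton ϑ α g₀ (fun m => Y m ω) n) y -
              PoissonQB.thetaHat ϑ (PoissonQB.newtonLimit ϑ α g₀ fun m => Y m ω) y))
          K := by
  have h : PoissonQB.NewtonModel μ ϑ α g₀ Y hY :=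
    ⟨hϑ_pos, hα, ⟨fun i => (hg₀_pos i).le, hg₀_sum⟩, hmodel, hα_sq⟩
  refine ⟨?_, fun y => ⟨?_, ?_⟩⟩
  · filter_upwards [h.ae_tendsto_mixLim, h.ae_mixLim_mem] with ω h1 h2
    exact ⟨h1, h2⟩
  · filter_upwards [h.ae_mixLim_mem] with ω hω j j'
    exact PoissonQB.summable_mixture_mul_score hϑ_pos hω y j j'
  · classical
    have hgood : MeasurableSet {ω | PoissonQB.mixLim ϑ α g₀ Y ω ∈ stdSimplex ℝ (Fin k → Fin d)} :=
      (measurable_pi_lambda _ (PoissonQB.measurable_mixLim hY))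
        (isClosed_stdSimplex ℝ _).measurableSet
    -- The covariance must be positive semidefinite for every outcome, so on the null set where the
    -- limit leaves the simplex it is replaced by `g₀`.
    let g' : Ω → (Fin k → Fin d) → ℝ := fun ω =>
      if PoissonQB.mixLim ϑ α g₀ Y ω ∈ stdSimplex ℝ (Fin k → Fin d) then
        PoissonQB.mixLim ϑ α g₀ Y ω else g₀
    have hg'mem (ω) : g' ω ∈ stdSimplex ℝ (Fin k → Fin d) := by
      by_cases hω : PoissonQB.mixLim ϑ α g₀ Y ω ∈ stdSimplex ℝ (Fin k → Fin d)
      · simpa only [g', if_pos hω] using hω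
      · simpa only [g', if_neg hω] using h.init_mem
    have hg'ae : ∀ᵐ ω ∂μ, g' ω = PoissonQB.mixLim ϑ α g₀ Y ω :=
      h.ae_mixLim_mem.mono fun ω hω => if_pos hω
    have hg'm (i) : Measurable fun ω => g' ω i :=
      measurable_pi_iff.1 (Measurable.ite hgood
        (measurable_pi_lambda _ (PoissonQB.measurable_mixLim hY)) measurable_const) i
    have hSm (j j') : Measurable fun ω => PoissonQB.covW ϑ (g' ω) y j j' :=
      PoissonQB.measurable_covW hg'm y j j'
    have hSpsd (ω) : (PoissonQB.covW ϑ (g' ω) y).PosSemidef :=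
      PoissonQB.posSemidef_covW hϑ_pos (hg'mem ω) y
    let K : Kernel Ω (EuclideanSpace ℝ (Fin k)) :=
      ⟨fun ω => multivariateGaussian 0 (PoissonQB.covW ϑ (g' ω) y),
        PoissonQB.measurable_multivariateGaussian hSm hSpsd⟩
    have hK : IsMarkovKernel K := ⟨fun ω => by change IsProbabilityMeasure (multivariateGaussian 0 _); infer_instance⟩
    refine ⟨K, hK, fun ω => PoissonQB.covW ϑ (g' ω) y, ⟨hSm, hSpsd, fun _ => rfl⟩, ?_, ?_, ?_⟩
    · filter_upwards [hg'ae] with ω hω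
      rw [hω]
    · exact fun n => (PoissonQB.measurable_scaledError hY y √(b n) n).aemeasurable
    · filter_upwards [hg'ae, h.ae_forall_tendsto_charFun_condLaw hb_pos hb_top hαb_sup hαb_sum y]
        with ω h1 h2
      -- Lévy's continuity theorem, outcome by outcome; the null set does not depend on `t`.
      refine ProbabilityMeasure.tendsto_of_tendsto_charFun fun t => ?_
      have h3 := h2 t
      rw [← h1] at h3
      exact h3
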